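/- Let $2<p<\infty$, let $(\Omega,\Sigma,\mathbb P)$ be an atomless and separable probability space, and let $L_p=L_p(\Omega,\Sigma,\mathbb P)$ be the associated Banach space of real-valued functions. (Separable means that there is a countable family $\mathcal A\subseteq\Sigma$ such that for every $S\in\Sigma$ and $\varepsilon>0$ there is $A\in\mathcal A$ with $\mathbb P(S\,\triangle\,A)<\varepsilon$.) Let $\ell_p(\ell_2)$ be the real Banach space of all sequences $(x_m)_{m\in\mathbb N}$ in $\ell_2$ with $\|(x_m)\|=\big(\sum_{m}\|x_m\|_2^p\big)^{1/p}<\infty$. If $X$ is a linear subspace of $L_p$ which, with the norm of $L_p$, is isomorphic (that is, linearly homeomorphic) to $\ell_p(\ell_2)$, then there is a linear subspace $Y\subseteq X$ which is isomorphic to $\ell_p(\ell_2)$ and complemented in $L_p$, i.e. there is a bounded linear projection of $L_p$ onto $Y$. -/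

import Mathlib

open MeasureTheory
open scoped ENNReal

/-- A measure is atomless if every measurable set of positive measure has a measurable subset
of strictly smaller positive measure. -/
def AtomlessMeasure {Ω : Type*} [MeasurableSpace Ω] (μ : Measure Ω) : Prop :=
  ∀ A : Set Ω, MeasurableSet A → 0 < μ A →
    ∃ B : Set Ω, B ⊆ A ∧ MeasurableSet B ∧ 0 < μ B ∧ μ B < μ A

/-- The real Banach space `ℓ_p(ℓ_2)`: sequences `(x m)` of elements of `ℓ_2` with
`∑ m, ‖x m‖ ^ p < ∞`, normed by `(∑ m, ‖x m‖ ^ p) ^ (1 / p)`. -/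
abbrev EllpEllTwo (p : ℝ≥0∞) : Type :=
  lp (fun _ : ℕ => lp (fun _ : ℕ => ℝ) 2) p

/-!
Let `T` be an embedding of `ℓ_p(ℓ₂)` into `L_p(μ)`, `2 < p < ∞`, and let `x m n` be the image of the
`n`-th unit vector of the `m`-th summand. It suffices to find an operator `U` of `ℓ_p(ℓ₂)` into
itself such that `T ∘ U` has a bounded left inverse `Q`: then `(T ∘ U) ∘ Q` is a projection onto a
copy of `ℓ_p(ℓ₂)` inside the range of `T`.

Left inverses come from Hilbert spaces (`exists_factorization_of_hilbert_maps`). Suppose that there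
are operators `J k` from `L_p(μ)` to Hilbert spaces with `∑ k, ‖J k f‖ ^ p ≤ C ‖f‖ ^ p`, and
distinct indices `m k`, such that `‖J k (x (m k) n)‖ ≥ δ` for all `k` and `n`. Finitely many linear
conditions cost almost nothing far out in `ℓ₂`, so normalized vectors `u k n` of `ℓ₂` can be chosen
recursively, orthonormal and such that the images `z k n` of `u k n`, placed in the summand `m k`,
satisfy `⟪J k (z k n), J k (z k' n')⟫ = 0` for `(k, n) ≠ (k', n')`. The functionals
`⟪J k (z k n), J k f⟫ / ‖J k (z k n)‖ ^ 2` are then exactly biorthogonal to the vectors `z k n`, and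
by Bessel's inequality they define an operator from `L_p(μ)` to `ℓ_p(ℓ₂)`.

The operators `J k` are the inclusions of `L_p(μ)` into `L₂` of measures `ρ` living on disjoint
sets. For fixed `m`, Khintchine's inequality shows that the convex combinations of the squares
`(x m n) ^ 2` stay away from `0` in `L_{p/2}(μ)`, uniformly in `m`. By the Hahn-Banach theorem some
positive functional on `L_{p/2}(μ)` is at least `1` on all these squares; it is integration against
a measure `ρ m`, whose density lies in the dual Lebesgue space
(`exists_measure_of_dominates_ellTwo`, `lintegral_rnDeriv_rpow_le`). On the other hand the `m`-th
summand becomes small in `L₂(μ)` as `m → ∞`: a signed sum of unit vectors from `N` summands has norm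
`N ^ (1 / p)`, much less than `N ^ (1 / 2)` (`eventually_norm_summand_le`). So only large values of
the density of `ρ m` matter, that is, a set of small measure. A subsequence can therefore be
restricted to disjoint sets (`exists_disjoint_sets_of_tendsto_zero`), and disjointness gives
`∑ k, ‖J k f‖ ^ p ≤ C ‖f‖ ^ p`.
-/

open Filter Topology NNReal

/-! ### Recursion, and far out unit vectors of `ℓ₂` -/

/-- Course-of-values recursion: `step j v` produces the `j`-th term from a function `v`
whose values below `j` are the earlier terms (the values from `j` on are junk). -/
noncomputable def strongSeq {α : Type*} [Inhabited α] (step : ℕ → (ℕ → α) → α) : ℕ → α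
  | j => step j (fun i => if _h : i < j then strongSeq step i else default)

/-- A sequence can be built term by term, each term being chosen in view of its index and of the
finitely many earlier terms. -/
theorem exists_seq_of_forall_initial {α : Type*} [Inhabited α] {P : ℕ → α → Prop}
    {r : ℕ → ℕ → α → α → Prop}
    (h : ∀ (j : ℕ) (v : ℕ → α), (∀ i < j, P i (v i)) → ∃ y, P j y ∧ ∀ i < j, r i j (v i) y) :
    ∃ f : ℕ → α, (∀ j, P j (f j)) ∧ ∀ i j, i < j → r i j (f i) (f j) := by
  classical
  let step : ℕ → (ℕ → α) → α := fun j v =>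
    if hv : ∀ i < j, P i (v i) then (h j v hv).choose else default
  have key : ∀ j, P j (strongSeq step j) ∧
      ∀ i < j, r i j (strongSeq step i) (strongSeq step j) := by
    intro j
    induction j using Nat.strong_induction_on with
    | _ j ih =>
      set v : ℕ → α := fun i => if _h : i < j then strongSeq step i else default with hvdef
      have hval : ∀ i < j, v i = strongSeq step i := fun i hi => by simp [hvdef, hi]
      have hv : ∀ i < j, P i (v i) := fun i hi => by rw [hval i hi]; exact (ih i hi).1
      have e : strongSeq step j = (h j v hv).choose := by
        rw [strongSeq]
        exact dif_pos hv
      have hs := (h j v hv).choose_spec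
      rw [← e] at hs
      exact ⟨hs.1, fun i hi => by rw [← hval i hi]; exact hs.2 i hi⟩
  exact ⟨strongSeq step, fun j => (key j).1, fun i j hij => (key j).2 i hij⟩

/-- The real Hilbert space `ℓ₂`. -/
abbrev EllTwo : Type := lp (fun _ : ℕ => ℝ) 2

/-- The standard unit vectors of `ℓ₂`. -/
noncomputable def ellTwoUnit (n : ℕ) : EllTwo := lp.single 2 n (1 : ℝ)

theorem norm_ellTwoUnit (n : ℕ) : ‖ellTwoUnit n‖ = 1 := by
  rw [ellTwoUnit, lp.norm_single (by norm_num)]; simp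

/-- The standard unit vectors of `ℓ₂` are weakly null. -/
theorem tendsto_apply_ellTwoUnit (φ : EllTwo →L[ℝ] ℝ) :
    Filter.Tendsto (fun n => φ (ellTwoUnit n)) Filter.atTop (nhds 0) := by
  set v := (InnerProductSpace.toDual ℝ EllTwo).symm φ with hv
  have h1 : ∀ n, φ (ellTwoUnit n) = v n := by
    intro n
    have : φ (ellTwoUnit n) = inner ℝ v (ellTwoUnit n) := by
      rw [hv, InnerProductSpace.toDual_symm_apply]
    rw [this, ellTwoUnit, lp.inner_single_right]
    simp
  simp_rw [h1]
  have h2 := (lp.hasSum_norm (p := 2) (by norm_num) v).summable.tendsto_atTop_zero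
  simp only [ENNReal.toReal_ofNat, Real.rpow_two] at h2
  have h3 := (Real.continuous_sqrt.tendsto 0).comp h2
  rw [tendsto_zero_iff_norm_tendsto_zero]
  simpa [Function.comp_def, Real.sqrt_sq_eq_abs] using h3

/-- If an operator on `ℓ₂` is bounded below by `δ` on the unit vectors, then every finite
codimensional subspace contains a normalized vector on which it is bounded below by `δ / 2`:
a far out unit vector is almost in the subspace. -/
theorem exists_unit_mem_ker_of_le_norm {H : Type*} [NormedAddCommGroup H] [NormedSpace ℝ H]
    (A : EllTwo →L[ℝ] H) {δ : ℝ} (hδ : 0 < δ) (hA : ∀ n, δ ≤ ‖A (ellTwoUnit n)‖)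
    {ι : Type*} [Fintype ι] (φ : ι → EllTwo →L[ℝ] ℝ) :
    ∃ y : EllTwo, ‖y‖ = 1 ∧ (∀ i, φ i y = 0) ∧ δ / 2 ≤ ‖A y‖ := by
  let Φ : EllTwo →ₗ[ℝ] (ι → ℝ) := (ContinuousLinearMap.pi φ : EllTwo →L[ℝ] (ι → ℝ))
  obtain ⟨σ, hσ⟩ := Φ.rangeRestrict.exists_rightInverse_of_surjective
    (LinearMap.range_eq_top.2 Φ.surjective_rangeRestrict)
  have hσc : Continuous σ := σ.continuous_of_finiteDimensional
  have hΦ0 : Filter.Tendsto (fun n => Φ.rangeRestrict (ellTwoUnit n)) Filter.atTop (nhds 0) := by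
    rw [tendsto_subtype_rng]
    exact tendsto_pi_nhds.2 fun i => tendsto_apply_ellTwoUnit (φ i)
  have hz := (hσc.tendsto 0).comp hΦ0
  rw [map_zero] at hz
  have hAz := (A.continuous.tendsto 0).comp hz
  rw [map_zero] at hAz
  have e1 := hz.norm.eventually_lt_const (u := 1 / 2) (by simp)
  have e2 := hAz.norm.eventually_lt_const (u := δ / 4) (by simpa using hδ)
  obtain ⟨n, hn1, hn2⟩ := (e1.and e2).exists
  simp only [Function.comp_apply] at hn1 hn2
  set z := σ (Φ.rangeRestrict (ellTwoUnit n))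
  have hker : ∀ i, φ i (ellTwoUnit n - z) = 0 := by
    intro i
    have h := LinearMap.congr_fun hσ (Φ.rangeRestrict (ellTwoUnit n))
    have h' : Φ z = Φ (ellTwoUnit n) := congrArg Subtype.val h
    have h'' : φ i z = φ i (ellTwoUnit n) := congrFun h' i
    rw [map_sub, h'', sub_self]
  have hup : ‖ellTwoUnit n - z‖ ≤ 3 / 2 := by
    have := norm_sub_le (ellTwoUnit n) z
    rw [norm_ellTwoUnit] at this
    linarith
  have hlow : 1 / 2 ≤ ‖ellTwoUnit n - z‖ := by
    have := norm_sub_norm_le (ellTwoUnit n) z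
    rw [norm_ellTwoUnit] at this
    linarith
  have hAlow : 3 / 4 * δ ≤ ‖A (ellTwoUnit n - z)‖ := by
    rw [map_sub]
    have := norm_sub_norm_le (A (ellTwoUnit n)) (A z)
    have := hA n
    linarith
  have hpos : 0 < ‖ellTwoUnit n - z‖ := by linarith
  refine ⟨‖ellTwoUnit n - z‖⁻¹ • (ellTwoUnit n - z), ?_, fun i => ?_, ?_⟩
  · rw [norm_smul, norm_inv, norm_norm, inv_mul_cancel₀ hpos.ne']
  · rw [map_smul, hker, smul_zero]
  · rw [map_smul, norm_smul, norm_inv, norm_norm, inv_mul_eq_div, le_div_iff₀ hpos]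
    nlinarith

/-! ### Hilbert space maps and complemented copies of `ℓ_p(ℓ₂)` -/

/-- The embedding of `ℓ₂` as the `m`-th summand of `ℓ_p(ℓ₂)`. -/
noncomputable def summand (p : ℝ≥0∞) [Fact (1 ≤ p)] (m : ℕ) : EllTwo →L[ℝ] EllpEllTwo p :=
  lp.singleContinuousLinearMap ℝ (fun _ : ℕ => EllTwo) p m

theorem summand_apply (p : ℝ≥0∞) [Fact (1 ≤ p)] (m : ℕ) (u : EllTwo) :
    summand p m u = lp.single p m u := rfl

/-- Biorthogonal block vectors. The orthonormal vectors `u j` are distributed over the summands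
`m k` by `Nat.unpair`, in such a way that the images of distinct ones are orthogonal
in the Hilbert spaces of both indices. -/
theorem exists_biorthogonal_blocks {p : ℝ≥0∞} [Fact (1 ≤ p)]
    {E : Type*} [NormedAddCommGroup E] [NormedSpace ℝ E]
    {H : ℕ → Type*} [∀ k, NormedAddCommGroup (H k)] [∀ k, InnerProductSpace ℝ (H k)]
    (J : ∀ k, E →L[ℝ] H k) (T : EllpEllTwo p →L[ℝ] E) (m : ℕ → ℕ)
    {δ : ℝ} (hδ : 0 < δ) (hT : ∀ k n, δ ≤ ‖J k (T (summand p (m k) (ellTwoUnit n)))‖) :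
    ∃ u : ℕ → EllTwo, Orthonormal ℝ u ∧
      (∀ j, δ / 2 ≤ ‖J j.unpair.1 (T (summand p (m j.unpair.1) (u j)))‖) ∧
      ∀ i j, i ≠ j → inner ℝ (J i.unpair.1 (T (summand p (m i.unpair.1) (u i))))
        (J i.unpair.1 (T (summand p (m j.unpair.1) (u j)))) = 0 := by
  let S : ℕ → EllTwo →L[ℝ] E := fun j => T.comp (summand p (m j.unpair.1))
  have : Inhabited EllTwo := ⟨0⟩
  have key := exists_seq_of_forall_initial (α := EllTwo)
    (P := fun j y => ‖y‖ = 1 ∧ δ / 2 ≤ ‖J j.unpair.1 (S j y)‖)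
    (r := fun i j x y => inner ℝ x y = 0 ∧
      inner ℝ (J i.unpair.1 (S i x)) (J i.unpair.1 (S j y)) = 0 ∧
      inner ℝ (J j.unpair.1 (S i x)) (J j.unpair.1 (S j y)) = 0) ?_
  · obtain ⟨u, hu, hr⟩ := key
    refine ⟨u, ⟨fun j => (hu j).1, fun i j hij => ?_⟩, fun j => (hu j).2, fun i j hij => ?_⟩
    · rcases lt_or_gt_of_ne hij with h | h
      · exact (hr i j h).1
      · rw [real_inner_comm]; exact (hr j i h).1
    · rcases lt_or_gt_of_ne hij with h | h
      · exact (hr i j h).2.1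
      · rw [real_inner_comm]; exact (hr j i h).2.2
  · intro j v _
    let φ : Fin j ⊕ Fin j ⊕ Fin j → EllTwo →L[ℝ] ℝ := Sum.elim
      (fun i => innerSL ℝ (v i))
      (Sum.elim
        (fun i => (innerSL ℝ (J (i : ℕ).unpair.1 (S i (v i)))).comp
          ((J (i : ℕ).unpair.1).comp (S j)))
        (fun i => (innerSL ℝ (J j.unpair.1 (S i (v i)))).comp ((J j.unpair.1).comp (S j))))
    obtain ⟨y, hy1, hy2, hy3⟩ := exists_unit_mem_ker_of_le_norm
      ((J j.unpair.1).comp (S j)) hδ (fun n => hT _ n) φ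
    refine ⟨y, ⟨hy1, hy3⟩, fun i hi => ⟨?_, ?_, ?_⟩⟩
    · exact hy2 (Sum.inl ⟨i, hi⟩)
    · exact hy2 (Sum.inr (Sum.inl ⟨i, hi⟩))
    · exact hy2 (Sum.inr (Sum.inr ⟨i, hi⟩))

/-- Operators into `ℓ₂` whose norms along every vector `f` are `p`-summable, with a bound
proportional to `‖f‖`, assemble to an operator into `ℓ_p(ℓ₂)`. -/
theorem exists_operator_into_EllpEllTwo {p : ℝ≥0∞} [Fact (1 ≤ p)] (hp : p ≠ ∞)
    {E : Type*} [NormedAddCommGroup E] [NormedSpace ℝ E] (q : ℕ → E →L[ℝ] EllTwo) {C : ℝ}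
    (hC : 0 ≤ C)
    (hq : ∀ f (s : Finset ℕ), ∑ k ∈ s, ‖q k f‖ ^ p.toReal ≤ (C * ‖f‖) ^ p.toReal) :
    ∃ Q : E →L[ℝ] EllpEllTwo p, ∀ f k, Q f k = q k f := by
  have hp0 : 0 < p.toReal :=
    ENNReal.toReal_pos (zero_lt_one.trans_le (Fact.out : 1 ≤ p)).ne' hp
  have hmem : ∀ f, Memℓp (fun k => q k f) p := fun f => memℓp_gen' (hq f)
  let L : E →ₗ[ℝ] EllpEllTwo p :=
    { toFun := fun f => ⟨fun k => q k f, hmem f⟩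
      map_add' := fun f g => by ext1; funext k; exact map_add (q k) f g
      map_smul' := fun c f => by ext1; funext k; exact map_smul (q k) c f }
  refine ⟨L.mkContinuous C fun f => ?_, fun f k => rfl⟩
  exact lp.norm_le_of_forall_sum_le hp0 (by positivity) (hq f)

/-- Orthogonal vectors of norm at least `δ` in a Hilbert space have biorthogonal functionals that
together define an operator into `ℓ₂`; its bound is Bessel's inequality. -/
theorem exists_biorthogonal_operator {H : Type*} [NormedAddCommGroup H] [InnerProductSpace ℝ H]
    (z : ℕ → H) {δ : ℝ} (hδ : 0 < δ) (hz : ∀ n, δ ≤ ‖z n‖)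
    (horth : ∀ i j, i ≠ j → inner ℝ (z i) (z j) = 0) :
    ∃ R : H →L[ℝ] EllTwo, (∀ g, ‖R g‖ ≤ δ⁻¹ * ‖g‖) ∧
      ∀ g n, R g n = inner ℝ (z n) g / ‖z n‖ ^ 2 := by
  have hpos : ∀ n, 0 < ‖z n‖ := fun n => hδ.trans_le (hz n)
  let w : ℕ → H := fun n => ‖z n‖⁻¹ • z n
  have hw : Orthonormal ℝ w := by
    refine ⟨fun n => ?_, fun i j hij => ?_⟩
    · simp only [w]
      rw [norm_smul, norm_inv, norm_norm, inv_mul_cancel₀ (hpos n).ne']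
    · simp only [w]
      rw [real_inner_smul_left, real_inner_smul_right, horth i j hij]
      simp
  have hle : ∀ g n, |inner ℝ (z n) g / ‖z n‖ ^ 2| ≤ δ⁻¹ * ‖inner ℝ (w n) g‖ := by
    intro g n
    have e : inner ℝ (z n) g / ‖z n‖ ^ 2 = ‖z n‖⁻¹ * inner ℝ (w n) g := by
      simp only [w]
      rw [real_inner_smul_left]
      have := (hpos n).ne'
      field_simp
    rw [e, abs_mul, Real.norm_eq_abs, abs_of_pos (inv_pos.2 (hpos n))]
    gcongr
    exact hz n
  have hsum : ∀ g (s : Finset ℕ),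
      ∑ n ∈ s, ‖inner ℝ (z n) g / ‖z n‖ ^ 2‖ ^ (2 : ℝ≥0∞).toReal ≤
        (δ⁻¹ * ‖g‖) ^ (2 : ℝ≥0∞).toReal := by
    intro g s
    simp only [ENNReal.toReal_ofNat, Real.rpow_two, Real.norm_eq_abs]
    calc ∑ n ∈ s, |inner ℝ (z n) g / ‖z n‖ ^ 2| ^ 2
        ≤ ∑ n ∈ s, (δ⁻¹) ^ 2 * ‖inner ℝ (w n) g‖ ^ 2 := by
          refine Finset.sum_le_sum fun n _ => ?_
          rw [← mul_pow]
          exact pow_le_pow_left₀ (abs_nonneg _) (hle g n) 2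
      _ = (δ⁻¹) ^ 2 * ∑ n ∈ s, ‖inner ℝ (w n) g‖ ^ 2 := by rw [Finset.mul_sum]
      _ ≤ (δ⁻¹) ^ 2 * ‖g‖ ^ 2 := by
          gcongr
          exact hw.sum_inner_products_le g
      _ = (δ⁻¹ * ‖g‖) ^ 2 := by ring
  let L : H →ₗ[ℝ] EllTwo :=
    { toFun := fun g => ⟨fun n => inner ℝ (z n) g / ‖z n‖ ^ 2, memℓp_gen' (hsum g)⟩
      map_add' := fun f g => by
        ext1; funext n
        change inner ℝ (z n) (f + g) / ‖z n‖ ^ 2 =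
          inner ℝ (z n) f / ‖z n‖ ^ 2 + inner ℝ (z n) g / ‖z n‖ ^ 2
        rw [inner_add_right, add_div]
      map_smul' := fun c f => by
        ext1; funext n
        change inner ℝ (z n) (c • f) / ‖z n‖ ^ 2 = c * (inner ℝ (z n) f / ‖z n‖ ^ 2)
        rw [real_inner_smul_right, mul_div_assoc] }
  have hb : ∀ g, ‖L g‖ ≤ δ⁻¹ * ‖g‖ := fun g =>
    lp.norm_le_of_forall_sum_le (by norm_num) (by positivity) (hsum g)
  exact ⟨L.mkContinuous δ⁻¹ hb, hb, fun g n => rfl⟩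

/-- Orthonormal sequences in distinct summands of `ℓ_p(ℓ₂)` are the images of the unit vectors under
an operator. -/
theorem exists_operator_of_orthonormal_blocks {p : ℝ≥0∞} [Fact (1 ≤ p)] (hp : p ≠ ∞)
    {m : ℕ → ℕ} (hm : Function.Injective m) (u : ℕ → ℕ → EllTwo) (hu : ∀ k, Orthonormal ℝ (u k)) :
    ∃ U : EllpEllTwo p →L[ℝ] EllpEllTwo p,
      ∀ k n, U (summand p k (ellTwoUnit n)) = summand p (m k) (u k n) := by
  classical
  have hp0 : 0 < p.toReal :=
    ENNReal.toReal_pos (zero_lt_one.trans_le (Fact.out : 1 ≤ p)).ne' hp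
  let W : ℕ → EllTwo →ₗᵢ[ℝ] EllTwo := fun k => (hu k).orthogonalFamily.linearIsometry
  have hW : ∀ k n, W k (ellTwoUnit n) = u k n := by
    intro k n
    refine ((hu k).orthogonalFamily.linearIsometry_apply_single (1 : ℝ)).trans ?_
    simp
  let ev : ℕ → EllpEllTwo p →L[ℝ] EllTwo := fun k => lp.evalCLM ℝ (fun _ : ℕ => EllTwo) p k
  let q : ℕ → EllpEllTwo p →L[ℝ] EllTwo := fun i =>
    if h : ∃ k, m k = i then (W h.choose).toContinuousLinearMap.comp (ev h.choose) else 0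
  have hq : ∀ k a, q (m k) a = W k (a k) := by
    intro k a
    have h : ∃ k', m k' = m k := ⟨k, rfl⟩
    have hk : h.choose = k := hm h.choose_spec
    simp only [q, dif_pos h, hk]
    rfl
  have hq0 : ∀ i a, (∀ k, m k ≠ i) → q i a = 0 := by
    intro i a h
    simp only [q]
    rw [dif_neg (by push Not; exact h)]
    rfl
  obtain ⟨U, hU⟩ := exists_operator_into_EllpEllTwo hp q (C := 1) zero_le_one (fun a s => by
    rw [one_mul]
    have h1 : ∑ i ∈ s, ‖q i a‖ ^ p.toReal
        = ∑ k ∈ s.preimage m hm.injOn, ‖q (m k) a‖ ^ p.toReal := by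
      rw [Finset.sum_preimage m s hm.injOn (fun i => ‖q i a‖ ^ p.toReal)]
      intro i _ hi
      rw [hq0 i a (fun k hk => hi ⟨k, hk⟩), norm_zero, Real.zero_rpow hp0.ne']
    rw [h1]
    simp_rw [hq, LinearIsometry.norm_map]
    exact lp.sum_rpow_le_norm_rpow hp0 a _)
  refine ⟨U, fun k n => ?_⟩
  ext1
  funext i
  rw [hU]
  by_cases h : ∃ k', m k' = i
  · obtain ⟨k', rfl⟩ := h
    rw [hq, summand_apply, summand_apply]
    by_cases hk : k' = k
    · subst hk
      rw [lp.single_apply_self, lp.single_apply_self, hW]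
    · rw [lp.single_apply_ne _ _ _ hk, lp.single_apply_ne _ _ _ (fun h => hk (hm h)), map_zero]
  · rw [hq0 i _ (by push Not at h; exact h), summand_apply, lp.single_apply_ne]
    rintro rfl
    exact h ⟨k, rfl⟩

/-- The unit vectors span a dense subspace of `ℓ_p(ℓ₂)`. -/
theorem ext_of_eq_on_units {p : ℝ≥0∞} [Fact (1 ≤ p)] (hp : p ≠ ∞)
    {F : Type*} [NormedAddCommGroup F] [NormedSpace ℝ F] {A B : EllpEllTwo p →L[ℝ] F}
    (h : ∀ k n, A (summand p k (ellTwoUnit n)) = B (summand p k (ellTwoUnit n))) : A = B := by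
  have h1 : ∀ k (a : EllTwo), A (summand p k a) = B (summand p k a) := by
    intro k a
    have ha := lp.hasSum_single (p := 2) (by norm_num) a
    have hA := ha.mapL (A.comp (summand p k))
    have hB := ha.mapL (B.comp (summand p k))
    have e : ∀ n, (lp.single 2 n (a n) : EllTwo) = a n • ellTwoUnit n := fun n => by
      rw [ellTwoUnit, ← lp.single_smul, smul_eq_mul, mul_one]
    simp only [ContinuousLinearMap.comp_apply, e, map_smul, h] at hA hB
    exact hA.unique hB
  refine ContinuousLinearMap.ext fun a => ?_
  have ha := lp.hasSum_single (p := p) hp a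
  refine (ha.mapL A).unique ?_
  simpa only [← summand_apply, ← h1] using ha.mapL B

/-- The Hilbert space criterion for complemented copies of `ℓ_p(ℓ₂)`: `T ∘ U` sends the `n`-th unit
vector of the `k`-th summand to the image of a block vector, and `Q` collects the functionals
biorthogonal to these images. -/
theorem exists_factorization_of_hilbert_maps {p : ℝ≥0∞} [Fact (1 ≤ p)] (hp : p ≠ ∞)
    {E : Type*} [NormedAddCommGroup E] [NormedSpace ℝ E]
    {H : ℕ → Type*} [∀ k, NormedAddCommGroup (H k)] [∀ k, InnerProductSpace ℝ (H k)]
    (J : ∀ k, E →L[ℝ] H k) {C : ℝ} (hC : 0 ≤ C)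
    (hJ : ∀ f (s : Finset ℕ), ∑ k ∈ s, ‖J k f‖ ^ p.toReal ≤ (C * ‖f‖) ^ p.toReal)
    (T : EllpEllTwo p →L[ℝ] E) {m : ℕ → ℕ} (hm : Function.Injective m)
    {δ : ℝ} (hδ : 0 < δ) (hT : ∀ k n, δ ≤ ‖J k (T (summand p (m k) (ellTwoUnit n)))‖) :
    ∃ (U : EllpEllTwo p →L[ℝ] EllpEllTwo p) (Q : E →L[ℝ] EllpEllTwo p),
      Q.comp (T.comp U) = ContinuousLinearMap.id ℝ _ := by
  have hp0 : 0 < p.toReal :=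
    ENNReal.toReal_pos (zero_lt_one.trans_le (Fact.out : 1 ≤ p)).ne' hp
  obtain ⟨u, hu, hlow, horth⟩ := exists_biorthogonal_blocks J T m hδ hT
  obtain ⟨U, hU⟩ := exists_operator_of_orthonormal_blocks hp hm (fun k n => u (Nat.pair k n))
    (fun k => hu.comp (fun n => Nat.pair k n) (fun a b hab => (Nat.pair_eq_pair.1 hab).2))
  let z : ∀ k, ℕ → H k := fun k n => J k (T (summand p (m k) (u (Nat.pair k n))))
  have hz : ∀ k n, δ / 2 ≤ ‖z k n‖ := by
    intro k n
    have := hlow (Nat.pair k n)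
    rwa [Nat.unpair_pair] at this
  have hzo : ∀ k n k' n', (k, n) ≠ (k', n') →
      inner ℝ (z k n) (J k (T (summand p (m k') (u (Nat.pair k' n'))))) = 0 := by
    intro k n k' n' hne
    have := horth (Nat.pair k n) (Nat.pair k' n') (fun h => hne (by
      rw [Nat.pair_eq_pair] at h
      rw [h.1, h.2]))
    rwa [Nat.unpair_pair, Nat.unpair_pair] at this
  choose R hR1 hR2 using fun k => exists_biorthogonal_operator (z k) (half_pos hδ) (hz k)
    (fun i j hij => hzo k i k j (fun h => hij (Prod.ext_iff.1 h).2))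
  obtain ⟨Q, hQ⟩ := exists_operator_into_EllpEllTwo hp (fun k => (R k).comp (J k))
    (C := (δ / 2)⁻¹ * C) (by positivity) (fun f s => by
      calc ∑ k ∈ s, ‖((R k).comp (J k)) f‖ ^ p.toReal
          ≤ ∑ k ∈ s, ((δ / 2)⁻¹) ^ p.toReal * ‖J k f‖ ^ p.toReal := by
            refine Finset.sum_le_sum fun k _ => ?_
            rw [← Real.mul_rpow (by positivity) (norm_nonneg _)]
            exact Real.rpow_le_rpow (norm_nonneg _) (hR1 k _) hp0.le
        _ = ((δ / 2)⁻¹) ^ p.toReal * ∑ k ∈ s, ‖J k f‖ ^ p.toReal := by rw [Finset.mul_sum]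
        _ ≤ ((δ / 2)⁻¹) ^ p.toReal * (C * ‖f‖) ^ p.toReal := by gcongr; exact hJ f s
        _ = ((δ / 2)⁻¹ * C * ‖f‖) ^ p.toReal := by
            rw [← Real.mul_rpow (by positivity) (by positivity), mul_assoc])
  refine ⟨U, Q, ext_of_eq_on_units hp fun k n => ?_⟩
  simp only [ContinuousLinearMap.comp_apply, ContinuousLinearMap.id_apply, hU]
  ext1
  funext k'
  rw [hQ, summand_apply p k]
  ext1
  funext n'
  rw [ContinuousLinearMap.comp_apply, hR2]
  by_cases hk : k' = k
  · subst hk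
    rw [lp.single_apply_self]
    by_cases hn : n' = n
    · subst hn
      have hpos : 0 < ‖z k' n'‖ := (half_pos hδ).trans_le (hz k' n')
      rw [ellTwoUnit, lp.single_apply_self]
      change inner ℝ (z k' n') (z k' n') / ‖z k' n'‖ ^ 2 = 1
      rw [real_inner_self_eq_norm_sq, div_self (by positivity)]
    · rw [ellTwoUnit, lp.single_apply_ne _ _ _ hn, hzo, zero_div]
      exact fun h => hn (Prod.ext_iff.1 h).2
  · rw [lp.single_apply_ne _ _ _ hk, hzo, zero_div]
    · rfl
    · exact fun h => hk (Prod.ext_iff.1 h).1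

/-! ### Positive functionals on `L_s` as measures -/

/-- If the `L_q(ρ)` seminorm is dominated by the `L_p(μ)` norm, the identity map on functions is
a bounded operator from `L_p(μ)` to `L_q(ρ)`. -/
theorem exists_inclusion_Lp {Ω : Type*} [MeasurableSpace Ω] {μ ρ : Measure Ω} {p q : ℝ≥0∞}
    [Fact (1 ≤ p)] [Fact (1 ≤ q)] (hac : ρ ≪ μ) {c : ℝ≥0}
    (h : ∀ f : Ω → ℝ, AEStronglyMeasurable f μ → eLpNorm f q ρ ≤ c * eLpNorm f p μ) :
    ∃ J : Lp ℝ p μ →L[ℝ] Lp ℝ q ρ, ∀ f, J f =ᵐ[ρ] f := by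
  have hmem : ∀ f : Lp ℝ p μ, MemLp f q ρ := fun f =>
    ⟨(Lp.aestronglyMeasurable f).mono_ac hac,
      (h f (Lp.aestronglyMeasurable f)).trans_lt
        (ENNReal.mul_lt_top ENNReal.coe_lt_top (Lp.eLpNorm_lt_top f))⟩
  let L : Lp ℝ p μ →ₗ[ℝ] Lp ℝ q ρ :=
    { toFun := fun f => (hmem f).toLp f
      map_add' := fun f g => by
        rw [← MemLp.toLp_add]
        exact MemLp.toLp_congr _ _ (hac.ae_eq (Lp.coeFn_add f g))
      map_smul' := fun a f => by
        rw [RingHom.id_apply, ← MemLp.toLp_const_smul]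
        exact MemLp.toLp_congr _ _ (hac.ae_eq (Lp.coeFn_smul a f)) }
  refine ⟨L.mkContinuous c fun f => ?_, fun f => (hmem f).coeFn_toLp⟩
  change ‖(hmem f).toLp f‖ ≤ _
  rw [Lp.norm_toLp, Lp.norm_def, ← ENNReal.coe_toReal, ← ENNReal.toReal_mul]
  exact ENNReal.toReal_mono
    (ENNReal.mul_ne_top ENNReal.coe_ne_top (Lp.eLpNorm_ne_top f)) (h f (Lp.aestronglyMeasurable f))

theorem indicatorConstLp_one_nonneg {Ω : Type*} [MeasurableSpace Ω] {μ : Measure Ω}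
    [IsFiniteMeasure μ] {s : ℝ≥0∞} {A : Set Ω} (hA : MeasurableSet A) :
    0 ≤ indicatorConstLp s hA (measure_ne_top μ A) (1 : ℝ) := by
  rw [← Lp.coeFn_nonneg]
  filter_upwards [indicatorConstLp_coeFn (p := s) (hs := hA) (hμs := measure_ne_top μ A)
    (c := (1 : ℝ))] with x hx
  rw [hx]
  exact Set.indicator_nonneg (fun _ _ => zero_le_one) x

section PositiveFunctional

variable {Ω : Type*} [MeasurableSpace Ω] {μ : Measure Ω} [IsFiniteMeasure μ] {s : ℝ≥0∞}
  [Fact (1 ≤ s)]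

/-- Countable additivity of a positive functional on `L_s`, evaluated on indicator functions. -/
theorem hasSum_indicatorConstLp (hs : s ≠ ∞) (Ψ : Lp ℝ s μ →L[ℝ] ℝ)
    (hpos : ∀ f, 0 ≤ f → 0 ≤ Ψ f) {f : ℕ → Set Ω} (hf : ∀ i, MeasurableSet (f i))
    (hd : Pairwise (Function.onFun Disjoint f)) :
    HasSum (fun i => Ψ (indicatorConstLp s (hf i) (measure_ne_top μ _) 1))
      (Ψ (indicatorConstLp s (MeasurableSet.iUnion hf) (measure_ne_top μ _) 1)) := by
  rw [hasSum_iff_tendsto_nat_of_nonneg (fun i => hpos _ (indicatorConstLp_one_nonneg _))]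
  let t : ℕ → Set Ω := fun n => ⋃ i < n, f i
  have ht : ∀ n, MeasurableSet (t n) := fun n =>
    MeasurableSet.iUnion fun i => MeasurableSet.iUnion fun _ => hf i
  have hsub : ∀ n, t n ⊆ ⋃ i, f i := fun n => Set.iUnion₂_subset fun i _ => Set.subset_iUnion f i
  have hcongr : ∀ (A B : Set Ω) (hA : MeasurableSet A) (hB : MeasurableSet B), A = B →
      indicatorConstLp s hA (measure_ne_top μ A) (1 : ℝ) =
        indicatorConstLp s hB (measure_ne_top μ B) (1 : ℝ) := by
    intro A B hA hB h
    subst h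
    rfl
  have hsum : ∀ n, ∑ i ∈ Finset.range n, indicatorConstLp s (hf i) (measure_ne_top μ _) (1 : ℝ) =
      indicatorConstLp s (ht n) (measure_ne_top μ _) 1 := by
    intro n
    induction n with
    | zero =>
      rw [Finset.sum_range_zero, hcongr (t 0) ∅ (ht 0) MeasurableSet.empty (by simp [t]),
        indicatorConstLp_empty]
    | succ n ih =>
      rw [Finset.sum_range_succ, ih, hcongr (t (n + 1)) (t n ∪ f n) (ht _) ((ht n).union (hf n))
        (by simp only [t]; exact Set.biUnion_lt_succ f n)]
      refine (indicatorConstLp_disjoint_union (ht n) (hf n) (measure_ne_top μ _)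
        (measure_ne_top μ _) ?_ (1 : ℝ)).symm
      simp only [t, Set.disjoint_iUnion_left]
      exact fun i hi => hd hi.ne
  have hlim : Tendsto (fun n => μ ((⋃ i, f i) \ t n)) atTop (𝓝 0) := by
    have h := tendsto_measure_iInter_atTop (μ := μ) (s := fun n => (⋃ i, f i) \ t n)
      (fun n => ((MeasurableSet.iUnion hf).diff (ht n)).nullMeasurableSet)
      (fun a b hab => Set.sdiff_subset_sdiff_right
        (Set.biUnion_subset_biUnion_left fun i (hi : i < a) => lt_of_lt_of_le hi hab))
      ⟨0, measure_ne_top μ _⟩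
    have he : (⋂ n, (⋃ i, f i) \ t n) = ∅ := by
      rw [Set.eq_empty_iff_forall_notMem]
      intro x hx
      rw [Set.mem_iInter] at hx
      obtain ⟨i, hi⟩ := Set.mem_iUnion.1 (hx 0).1
      exact (hx (i + 1)).2 (Set.mem_biUnion (Nat.lt_succ_self i) hi)
    rwa [he, measure_empty] at h
  have hlim' : Tendsto (fun n => indicatorConstLp s (ht n) (measure_ne_top μ _) (1 : ℝ)) atTop
      (𝓝 (indicatorConstLp s (MeasurableSet.iUnion hf) (measure_ne_top μ _) 1)) := by
    refine tendsto_indicatorConstLp_set hs ?_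
    refine hlim.congr fun n => ?_
    rw [symmDiff_of_le (hsub n)]
  have := (Ψ.continuous.tendsto _).comp hlim'
  refine this.congr fun n => ?_
  rw [Function.comp_apply, ← hsum, map_sum]

/-- A positive functional on `L_s` of a finite measure is integration against a measure, whose `L₁`
norm is dominated by the `L_s` norm. -/
theorem exists_measure_eq_integral_of_positive (hs : s ≠ ∞) (Ψ : Lp ℝ s μ →L[ℝ] ℝ)
    (hpos : ∀ f, 0 ≤ f → 0 ≤ Ψ f) {c : ℝ≥0} (hc : ‖Ψ‖ ≤ c) :
    ∃ ρ : Measure Ω, IsFiniteMeasure ρ ∧ ρ ≪ μ ∧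
      (∀ f : Ω → ℝ, AEStronglyMeasurable f μ →
        eLpNorm f 1 ρ ≤ (2 * c : ℝ≥0) * eLpNorm f s μ) ∧
      ∀ f : Lp ℝ s μ, ∫ x, f x ∂ρ = Ψ f := by
  have hs0 : s ≠ 0 := (zero_lt_one.trans_le (Fact.out : 1 ≤ s)).ne'
  let ρ : Measure Ω := Measure.ofMeasurable
    (fun A hA => ENNReal.ofReal (Ψ (indicatorConstLp s hA (measure_ne_top μ A) 1)))
    (by rw [indicatorConstLp_empty, map_zero, ENNReal.ofReal_zero])
    (fun f hf hd => by
      rw [← (hasSum_indicatorConstLp hs Ψ hpos hf hd).tsum_eq,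
        ENNReal.ofReal_tsum_of_nonneg (fun i => hpos _ (indicatorConstLp_one_nonneg _))
          (hasSum_indicatorConstLp hs Ψ hpos hf hd).summable])
  have hρ : ∀ {A : Set Ω} (hA : MeasurableSet A),
      ρ A = ENNReal.ofReal (Ψ (indicatorConstLp s hA (measure_ne_top μ A) 1)) := fun hA =>
    Measure.ofMeasurable_apply _ hA
  have hfin : IsFiniteMeasure ρ := ⟨by rw [hρ MeasurableSet.univ]; exact ENNReal.ofReal_lt_top⟩
  have hac : ρ ≪ μ := by
    refine Measure.AbsolutelyContinuous.mk fun A hA h0 => ?_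
    have : indicatorConstLp s hA (measure_ne_top μ A) (1 : ℝ) = 0 := by
      rw [← norm_eq_zero, norm_indicatorConstLp hs0 hs]
      simp [measureReal_def, h0, ENNReal.toReal_eq_zero_iff, hs0, hs]
    rw [hρ hA, this, map_zero, ENNReal.ofReal_zero]
  have hindρ : ∀ (a : ℝ) {A : Set Ω} (hA : MeasurableSet A),
      ∫ x, A.indicator (fun _ => a) x ∂ρ =
        Ψ (indicatorConstLp s hA (measure_ne_top μ A) a) := by
    intro a A hA
    have e : indicatorConstLp s hA (measure_ne_top μ A) a =
        a • indicatorConstLp s hA (measure_ne_top μ A) (1 : ℝ) := by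
      ext1
      grw [Lp.coeFn_smul, indicatorConstLp_coeFn, indicatorConstLp_coeFn]
      filter_upwards with x
      by_cases hx : x ∈ A <;> simp [hx]
    rw [integral_indicator_const a hA, e, map_smul, measureReal_def, hρ hA,
      ENNReal.toReal_ofReal (hpos _ (indicatorConstLp_one_nonneg hA)), smul_eq_mul,
      smul_eq_mul, mul_comm]
  have hmem : ∀ f : SimpleFunc Ω ℝ, MemLp f s μ := fun f => f.memLp_of_isFiniteMeasure s μ
  have hsimple : ∀ f : SimpleFunc Ω ℝ, ∫ x, f x ∂ρ = Ψ ((hmem f).toLp f) := by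
    intro f
    induction f using SimpleFunc.induction with
    | const a hA =>
      rename_i A
      have h := hindρ a hA
      rw [indicatorConstLp] at h
      refine Eq.trans ?_ (h.trans (congrArg Ψ (MemLp.toLp_congr _ _ ?_)))
      · congr 1
      · filter_upwards with x
        by_cases hx : x ∈ A <;> simp [hx]
    | add _ hf hg =>
      rename_i f g _
      have e : (hmem (f + g)).toLp (f + g) = (hmem f).toLp f + (hmem g).toLp g := by
        rw [← MemLp.toLp_add]; rfl
      rw [e, map_add, ← hf, ← hg]
      exact integral_add (f.integrable_of_isFiniteMeasure) (g.integrable_of_isFiniteMeasure)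
  have hsimple_norm : ∀ f : SimpleFunc Ω ℝ, eLpNorm f 1 ρ ≤ c * eLpNorm f s μ := by
    intro f
    let g : SimpleFunc Ω ℝ := f.map fun r => ‖r‖
    have h1 : eLpNorm f 1 ρ = ENNReal.ofReal (∫ x, g x ∂ρ) := by
      rw [eLpNorm_one_eq_lintegral_enorm, ← ofReal_integral_norm_eq_lintegral_enorm
        (f.integrable_of_isFiniteMeasure)]
      rfl
    have h2 : eLpNorm f s μ = eLpNorm g s μ := (eLpNorm_norm (f : Ω → ℝ)).symm
    rw [h1, h2, hsimple]
    calc ENNReal.ofReal (Ψ ((hmem g).toLp g)) ≤ ENNReal.ofReal (c * ‖(hmem g).toLp g‖) := by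
          refine ENNReal.ofReal_le_ofReal ((le_abs_self _).trans ?_)
          exact (Ψ.le_opNorm _).trans (by gcongr)
      _ = c * eLpNorm g s μ := by
          rw [ENNReal.ofReal_mul c.coe_nonneg, Lp.norm_toLp, ENNReal.ofReal_toReal (hmem g).2.ne,
            ENNReal.ofReal_coe_nnreal]
  have hmeas : ∀ f : Ω → ℝ, Measurable f → eLpNorm f 1 ρ ≤ (2 * c : ℝ≥0) * eLpNorm f s μ := by
    intro f hf
    -- `approxOn` is only dominated by `2 * |f|`, which is the reason for the factor `2`
    let F : ℕ → SimpleFunc Ω ℝ := fun n =>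
      SimpleFunc.approxOn f hf Set.univ 0 (Set.mem_univ _) n
    have hF : ∀ n, eLpNorm (F n) 1 ρ ≤ (2 * c : ℝ≥0) * eLpNorm f s μ := by
      intro n
      refine (hsimple_norm (F n)).trans ?_
      have hle : eLpNorm (F n) s μ ≤ (2 : ℝ≥0) * eLpNorm f s μ := by
        have := eLpNorm_le_nnreal_smul_eLpNorm_of_ae_le_mul (f := F n) (g := f) (c := 2) (μ := μ)
          (ae_of_all _ fun x => by
            have h := SimpleFunc.norm_approxOn_zero_le hf (Set.mem_univ (0 : ℝ)) x n
            rw [← NNReal.coe_le_coe]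
            push_cast
            linarith) s
        exact this
      calc (c : ℝ≥0∞) * eLpNorm (F n) s μ ≤ c * ((2 : ℝ≥0) * eLpNorm f s μ) := by gcongr
        _ = _ := by rw [ENNReal.coe_mul]; ring
    refine (Lp.eLpNorm_lim_le_liminf_eLpNorm (f := fun n => F n)
      (fun n => (F n).aestronglyMeasurable) f ?_).trans ?_
    · exact ae_of_all _ fun x => SimpleFunc.tendsto_approxOn hf (Set.mem_univ _) (by simp)
    · exact liminf_le_of_le (by isBoundedDefault) fun b hb => by
        obtain ⟨n, hn⟩ := hb.exists
        exact hn.trans (hF n)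
  have hbound : ∀ f : Ω → ℝ, AEStronglyMeasurable f μ →
      eLpNorm f 1 ρ ≤ (2 * c : ℝ≥0) * eLpNorm f s μ := by
    intro f hf
    rw [eLpNorm_congr_ae (hac.ae_eq hf.ae_eq_mk), eLpNorm_congr_ae hf.ae_eq_mk]
    exact hmeas _ hf.stronglyMeasurable_mk.measurable
  refine ⟨ρ, hfin, hac, hbound, ?_⟩
  obtain ⟨J, hJ⟩ := exists_inclusion_Lp (p := s) (q := 1) hac hbound
  have hJi : ∀ f : Lp ℝ s μ, ∫ x, f x ∂ρ = L1.integralCLM (J f) := by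
    intro f
    rw [← L1.integral_def, L1.integral_eq_integral, integral_congr_ae (hJ f)]
  intro f
  rw [hJi]
  refine Lp.induction hs (motive := fun f => L1.integralCLM (J f) = Ψ f) ?_ ?_ ?_ f
  · intro a A hA hμA
    rw [← hJi, Lp.simpleFunc.coe_indicatorConst, ← hindρ a hA]
    exact integral_congr_ae (hac.ae_eq indicatorConstLp_coeFn)
  · intro f g hf hg _ h1 h2
    rw [map_add, map_add, h1, h2, map_add]
  · exact isClosed_eq (L1.integralCLM.continuous.comp J.continuous) Ψ.continuous

end PositiveFunctional

/-! ### Khintchine's inequality and separation from zero -/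

theorem rpow_le_rpow_self_mul_exp {P y : ℝ} (hP : 0 < P) (hy : 0 ≤ y) :
    y ^ P ≤ P ^ P * Real.exp y := by
  have h1 : y ≤ P * Real.exp (y / P) := by
    have := (Real.add_one_le_exp (y / P))
    have h2 : y / P ≤ Real.exp (y / P) := by linarith
    calc y = P * (y / P) := by field_simp
      _ ≤ _ := by gcongr
  calc y ^ P ≤ (P * Real.exp (y / P)) ^ P := Real.rpow_le_rpow hy h1 hP.le
    _ = P ^ P * Real.exp y := by
        rw [Real.mul_rpow hP.le (Real.exp_pos _).le, ← Real.exp_mul]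
        congr 2
        field_simp

/-- The moment generating function of a Rademacher sum is at most a Gaussian one. -/
theorem sum_powerset_exp_le {ι : Type*} [DecidableEq ι] (t : Finset ι) (b : ι → ℝ) :
    ∑ u ∈ t.powerset, Real.exp (∑ i ∈ u, b i - ∑ i ∈ t \ u, b i) ≤
      2 ^ t.card * Real.exp ((∑ i ∈ t, b i ^ 2) / 2) := by
  calc ∑ u ∈ t.powerset, Real.exp (∑ i ∈ u, b i - ∑ i ∈ t \ u, b i)
      = ∏ i ∈ t, (Real.exp (b i) + Real.exp (-b i)) := by
        rw [Finset.prod_add]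
        refine Finset.sum_congr rfl fun u _ => ?_
        rw [← Real.exp_sum, ← Real.exp_sum, ← Real.exp_add, Finset.sum_neg_distrib, sub_eq_add_neg]
    _ ≤ ∏ i ∈ t, (2 * Real.exp (b i ^ 2 / 2)) := by
        refine Finset.prod_le_prod (fun i _ => by positivity) fun i _ => ?_
        have := Real.cosh_le_exp_half_sq (b i)
        rw [Real.cosh_eq] at this
        linarith
    _ = 2 ^ t.card * Real.exp ((∑ i ∈ t, b i ^ 2) / 2) := by
        rw [Finset.prod_mul_distrib, Finset.prod_const, ← Real.exp_sum, Finset.sum_div]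

/-- Khintchine's inequality: the upper bound for the `P`-th moment of a Rademacher sum, the signs
being encoded by the set `u` of indices at which they are positive. -/
theorem sum_powerset_abs_rpow_le {ι : Type*} [DecidableEq ι] {P : ℝ} (hP : 0 < P)
    (t : Finset ι) (b : ι → ℝ) :
    ∑ u ∈ t.powerset, |∑ i ∈ u, b i - ∑ i ∈ t \ u, b i| ^ P ≤
      2 ^ t.card * (2 * P ^ P * Real.exp (1 / 2) * (∑ i ∈ t, b i ^ 2) ^ (P / 2)) := by
  set V := ∑ i ∈ t, b i ^ 2 with hV
  have hV0 : 0 ≤ V := Finset.sum_nonneg fun i _ => sq_nonneg _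
  rcases hV0.eq_or_lt with h0 | hpos
  · have hb : ∀ i ∈ t, b i = 0 := fun i hi =>
      pow_eq_zero_iff (two_ne_zero) |>.1
        ((Finset.sum_eq_zero_iff_of_nonneg (fun i _ => sq_nonneg (b i))).1 (hV ▸ h0.symm) i hi)
    rw [Finset.sum_eq_zero]
    · positivity
    · intro u hu
      rw [Finset.sum_eq_zero fun i hi => hb i (Finset.mem_powerset.1 hu hi),
        Finset.sum_eq_zero fun i hi => hb i (Finset.mem_sdiff.1 hi).1, sub_zero, abs_zero,
        Real.zero_rpow hP.ne']
  · set σ := Real.sqrt V with hσ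
    have hσ0 : 0 < σ := Real.sqrt_pos.2 hpos
    have hσP : σ ^ P = V ^ (P / 2) := by
      rw [hσ, Real.sqrt_eq_rpow, ← Real.rpow_mul hV0]
      congr 1
      ring
    let d : ι → ℝ := fun i => b i / σ
    have hd : ∑ i ∈ t, d i ^ 2 = 1 := by
      simp only [d, div_pow, ← Finset.sum_div]
      rw [← hV, hσ, Real.sq_sqrt hV0, div_self hpos.ne']
    have hterm : ∀ u ∈ t.powerset, |∑ i ∈ u, b i - ∑ i ∈ t \ u, b i| ^ P ≤
        σ ^ P * (P ^ P * (Real.exp (∑ i ∈ u, d i - ∑ i ∈ t \ u, d i) +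
          Real.exp (∑ i ∈ u, -d i - ∑ i ∈ t \ u, -d i))) := by
      intro u _
      set x := ∑ i ∈ u, d i - ∑ i ∈ t \ u, d i with hx
      have e1 : ∑ i ∈ u, b i - ∑ i ∈ t \ u, b i = σ * x := by
        simp only [hx, d, ← Finset.sum_div]
        field_simp
      have e2 : ∑ i ∈ u, -d i - ∑ i ∈ t \ u, -d i = -x := by
        simp only [hx, Finset.sum_neg_distrib]
        ring
      rw [e1, e2, abs_mul, abs_of_pos hσ0, Real.mul_rpow hσ0.le (abs_nonneg _)]
      gcongr
      refine (rpow_le_rpow_self_mul_exp hP (abs_nonneg x)).trans ?_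
      gcongr
      rcases abs_cases x with ⟨h, _⟩ | ⟨h, _⟩ <;> rw [h]
      · exact le_add_of_nonneg_right (Real.exp_pos _).le
      · exact le_add_of_nonneg_left (Real.exp_pos _).le
    refine (Finset.sum_le_sum hterm).trans ?_
    rw [← Finset.mul_sum, ← Finset.mul_sum, Finset.sum_add_distrib, hσP]
    have h1 := sum_powerset_exp_le t d
    have h2 := sum_powerset_exp_le t fun i => -d i
    simp only [neg_sq, hd] at h1 h2
    calc V ^ (P / 2) * (P ^ P * _) ≤ V ^ (P / 2) * (P ^ P *
          (2 ^ t.card * Real.exp (1 / 2) + 2 ^ t.card * Real.exp (1 / 2))) := by gcongr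
      _ = _ := by ring

/-- If all sign combinations of `x i`, `i ∈ t`, have `L_p` norm at least `c`, then so has, up to
Khintchine's constant, their square function. -/
theorem rpow_le_lintegral_square_function {Ω : Type*} [MeasurableSpace Ω] {μ : Measure Ω}
    {p : ℝ≥0∞} (hp0 : p ≠ 0) (hp : p ≠ ∞) {ι : Type*} [DecidableEq ι] (t : Finset ι)
    (x : ι → Ω → ℝ) (hx : ∀ i, AEStronglyMeasurable (x i) μ) {c : ℝ≥0∞}
    (hc : ∀ u ⊆ t, c ≤ eLpNorm (fun ω => ∑ i ∈ u, x i ω - ∑ i ∈ t \ u, x i ω) p μ) :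
    c ^ p.toReal ≤ ENNReal.ofReal (2 * p.toReal ^ p.toReal * Real.exp (1 / 2)) *
      ∫⁻ ω, ENNReal.ofReal ((∑ i ∈ t, x i ω ^ 2) ^ (p.toReal / 2)) ∂μ := by
  have hP : 0 < p.toReal := ENNReal.toReal_pos hp0 hp
  have hN0 : (2 : ℝ≥0∞) ^ t.card ≠ 0 := by positivity
  have hN1 : (2 : ℝ≥0∞) ^ t.card ≠ ∞ := ENNReal.pow_ne_top (by norm_num)
  rw [← ENNReal.mul_le_mul_iff_right hN0 hN1]
  calc (2 : ℝ≥0∞) ^ t.card * c ^ p.toReal = ∑ u ∈ t.powerset, c ^ p.toReal := by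
        rw [Finset.sum_const, Finset.card_powerset, nsmul_eq_mul]
        push_cast
        rfl
    _ ≤ ∑ u ∈ t.powerset,
          ∫⁻ ω, ENNReal.ofReal (|∑ i ∈ u, x i ω - ∑ i ∈ t \ u, x i ω| ^ p.toReal) ∂μ := by
        refine Finset.sum_le_sum fun u hu => ?_
        refine (ENNReal.rpow_le_rpow (hc u (Finset.mem_powerset.1 hu)) hP.le).trans_eq ?_
        rw [eLpNorm_eq_lintegral_rpow_enorm_toReal hp0 hp, ← ENNReal.rpow_mul,
          one_div_mul_cancel hP.ne', ENNReal.rpow_one]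
        refine lintegral_congr fun ω => ?_
        rw [Real.enorm_eq_ofReal_abs, ENNReal.ofReal_rpow_of_nonneg (abs_nonneg _) hP.le]
    _ = ∫⁻ ω, ∑ u ∈ t.powerset,
          ENNReal.ofReal (|∑ i ∈ u, x i ω - ∑ i ∈ t \ u, x i ω| ^ p.toReal) ∂μ := by
        rw [lintegral_finsetSum' _ fun u _ => ?_]
        refine AEMeasurable.ennreal_ofReal ?_
        have h1 : ∀ v : Finset ι, AEMeasurable (fun ω => ∑ i ∈ v, x i ω) μ := fun v =>
          Finset.aemeasurable_fun_sum v fun i _ => (hx i).aemeasurable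
        have h2 := ((h1 u).sub (h1 (t \ u))).norm.pow_const p.toReal
        exact h2
    _ ≤ ∫⁻ ω, ENNReal.ofReal (2 ^ t.card * (2 * p.toReal ^ p.toReal * Real.exp (1 / 2))) *
          ENNReal.ofReal ((∑ i ∈ t, x i ω ^ 2) ^ (p.toReal / 2)) ∂μ := by
        refine lintegral_mono fun ω => ?_
        rw [← ENNReal.ofReal_sum_of_nonneg fun u _ => by positivity,
          ← ENNReal.ofReal_mul (by positivity)]
        refine ENNReal.ofReal_le_ofReal ?_
        refine (sum_powerset_abs_rpow_le hP t fun i => x i ω).trans_eq ?_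
        ring
    _ = _ := by
        rw [lintegral_const_mul' _ _ ENNReal.ofReal_ne_top, ENNReal.ofReal_mul (by positivity),
          mul_assoc]
        congr 2
        rw [ENNReal.ofReal_pow (by norm_num)]
        norm_num

theorem MeasureTheory.Lp.smul_nonneg_of_nonneg {Ω : Type*} [MeasurableSpace Ω] {μ : Measure Ω}
    {s : ℝ≥0∞} {a : ℝ} (ha : 0 ≤ a) {f : Lp ℝ s μ} (hf : 0 ≤ f) : 0 ≤ a • f := by
  rw [← Lp.coeFn_nonneg] at hf ⊢
  filter_upwards [hf, Lp.coeFn_smul a f] with x hx hx'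
  rw [hx']
  exact mul_nonneg ha hx

open scoped Pointwise in
/-- If the convex combinations of nonnegative elements of `L_s` stay away from `0`, some positive
functional is bounded below on these elements. By the Hahn-Banach theorem a functional separates a
ball around `0` from the set of all elements above a convex combination; as this set is stable under
adding nonnegative elements, the functional is positive. -/
theorem exists_positive_functional_of_convex_lower_bound {Ω : Type*} [MeasurableSpace Ω]
    {μ : Measure Ω} {s : ℝ≥0∞} [Fact (1 ≤ s)] (g : ℕ → Lp ℝ s μ) (hg : ∀ n, 0 ≤ g n)
    {κ : ℝ} (hκ : 0 < κ)
    (h : ∀ w : ℕ →₀ ℝ, (∀ n, 0 ≤ w n) → w.sum (fun _ a => a) = 1 →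
      κ ≤ ‖Finsupp.linearCombination ℝ g w‖) :
    ∃ Ψ : Lp ℝ s μ →L[ℝ] ℝ, (∀ f, 0 ≤ f → 0 ≤ Ψ f) ∧ ‖Ψ‖ ≤ 2 / κ ∧ ∀ n, 1 ≤ Ψ (g n) := by
  let Δ : Set (ℕ →₀ ℝ) := {w | (∀ n, 0 ≤ w n) ∧ w.sum (fun _ a => a) = 1}
  have hΔ : Convex ℝ Δ := by
    intro v hv w hw a b ha hb hab
    refine ⟨fun n => ?_, ?_⟩
    · simp only [Finsupp.add_apply, Finsupp.smul_apply, smul_eq_mul]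
      have := hv.1 n
      have := hw.1 n
      positivity
    · rw [Finsupp.sum_add_index' (fun _ => rfl) (fun _ _ _ => rfl),
        Finsupp.sum_smul_index (fun _ => rfl), Finsupp.sum_smul_index (fun _ => rfl),
        ← Finsupp.mul_sum, ← Finsupp.mul_sum, hv.2, hw.2, mul_one, mul_one, hab]
  let cone : Set (Lp ℝ s μ) := {f | 0 ≤ f}
  have hcone : Convex ℝ cone := by
    intro v hv w hw a b ha hb _
    exact add_nonneg (Lp.smul_nonneg_of_nonneg ha hv) (Lp.smul_nonneg_of_nonneg hb hw)
  let K : Set (Lp ℝ s μ) := Finsupp.linearCombination ℝ g '' Δ + cone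
  have hK : Convex ℝ K := (hΔ.linear_image _).add hcone
  have hgK : ∀ n f, 0 ≤ f → g n + f ∈ K := by
    intro n f hf
    refine Set.add_mem_add ⟨Finsupp.single n 1, ⟨fun k => ?_, ?_⟩, ?_⟩ hf
    · rw [Finsupp.single_apply]; split_ifs <;> norm_num
    · simp
    · simp
  have hdisj : Disjoint (Metric.ball (0 : Lp ℝ s μ) κ) K := by
    rw [Set.disjoint_left]
    rintro f hf ⟨_, ⟨w, hw, rfl⟩, v, hv, rfl⟩
    have h0 : 0 ≤ Finsupp.linearCombination ℝ g w := by
      rw [Finsupp.linearCombination_apply]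
      exact Finset.sum_nonneg fun n _ => Lp.smul_nonneg_of_nonneg (hw.1 n) (hg n)
    have h1 := h w hw.1 hw.2
    have h2 : ‖Finsupp.linearCombination ℝ g w‖ ≤ ‖Finsupp.linearCombination ℝ g w + v‖ := by
      refine norm_le_norm_of_abs_le_abs ?_
      rw [abs_of_nonneg h0, abs_of_nonneg (add_nonneg h0 hv)]
      exact le_add_of_nonneg_right hv
    rw [mem_ball_zero_iff] at hf
    exact absurd hf (not_lt.2 (h1.trans h2))
  obtain ⟨Φ, a, hΦ1, hΦ2⟩ :=
    geometric_hahn_banach_open (convex_ball _ _) Metric.isOpen_ball hK hdisj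
  have ha : 0 < a := by
    have := hΦ1 0 (Metric.mem_ball_self hκ)
    rwa [map_zero] at this
  refine ⟨a⁻¹ • Φ, fun f hf => ?_, ?_, fun n => ?_⟩
  · have hΦf : 0 ≤ Φ f := by
      by_contra hneg
      push Not at hneg
      -- far along the ray `g 0 + r • f` the functional would become negative
      set r := |Φ (g 0)| / (-Φ f) with hr
      have hr0 : 0 ≤ r := div_nonneg (abs_nonneg _) (by linarith)
      have h1 := hΦ2 _ (hgK 0 (r • f) (Lp.smul_nonneg_of_nonneg hr0 hf))
      rw [map_add, map_smul, smul_eq_mul] at h1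
      have h2 : r * Φ f = -|Φ (g 0)| := by
        rw [hr]
        have : Φ f ≠ 0 := hneg.ne
        field_simp
      have := le_abs_self (Φ (g 0))
      linarith
    exact mul_nonneg (inv_nonneg.2 ha.le) hΦf
  · have hb : ‖Φ‖ ≤ a / (κ / 2) := by
      refine Φ.opNorm_bound_of_ball_bound (half_pos hκ) a fun f hf => ?_
      have hlt : ∀ f ∈ Metric.closedBall (0 : Lp ℝ s μ) (κ / 2), Φ f < a := fun f hf =>
        hΦ1 f (Metric.closedBall_subset_ball (half_lt_self hκ) hf)
      have h1 := hlt f hf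
      have h2 := hlt (-f) (by rwa [mem_closedBall_zero_iff, norm_neg, ← mem_closedBall_zero_iff])
      rw [map_neg] at h2
      exact abs_le.2 ⟨by linarith, h1.le⟩
    rw [norm_smul, norm_inv, Real.norm_of_nonneg ha.le]
    calc a⁻¹ * ‖Φ‖ ≤ a⁻¹ * (a / (κ / 2)) := by gcongr
      _ = 2 / κ := by field_simp
  · have h1 := hΦ2 _ (hgK n 0 le_rfl)
    rw [add_zero] at h1
    change 1 ≤ a⁻¹ * Φ (g n)
    rw [inv_mul_eq_div, le_div_iff₀ ha, one_mul]
    exact h1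

/-! ### A measure on which an `ℓ₂` sequence lives -/

theorem eLpNorm_sq {Ω : Type*} [MeasurableSpace Ω] (ρ : Measure Ω) (q : ℝ≥0∞) (f : Ω → ℝ) :
    eLpNorm (fun ω => f ω ^ 2) q ρ = eLpNorm f (q * 2) ρ ^ 2 := by
  have h := eLpNorm_norm_rpow (p := q) (μ := ρ) f (q := 2) (by norm_num)
  simpa only [Real.rpow_two, ENNReal.rpow_two, Real.norm_eq_abs, sq_abs, ENNReal.ofReal_ofNat]
    using h

/-- An `L_p` sequence, `p > 2`, that dominates the `ℓ₂` basis is bounded below in `L₂(ρ)` for some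
measure `ρ` whose `L₂` norm is controlled by the `L_p` norm. The constant `C` depends only on `p`
and on the constant `c` of domination. -/
theorem exists_measure_of_dominates_ellTwo {Ω : Type*} [MeasurableSpace Ω] (μ : Measure Ω)
    [IsFiniteMeasure μ] {p : ℝ≥0∞} [Fact (1 ≤ p)] (hp : 2 < p) (hp_top : p ≠ ∞) {c : ℝ}
    (hc : 0 < c) :
    ∃ C : ℝ≥0, ∀ x : ℕ → Lp ℝ p μ,
      (∀ (t : Finset ℕ) (a : ℕ → ℝ), c * √(∑ i ∈ t, a i ^ 2) ≤ ‖∑ i ∈ t, a i • x i‖) →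
      ∃ ρ : Measure Ω, IsFiniteMeasure ρ ∧ ρ ≪ μ ∧
        (∀ f : Ω → ℝ, AEStronglyMeasurable f μ → eLpNorm f 1 ρ ≤ C * eLpNorm f (p / 2) μ) ∧
        ∀ n, 1 ≤ eLpNorm (x n) 2 ρ := by
  set P := p.toReal with hPdef
  have hp0 : p ≠ 0 := (zero_lt_one.trans_le (Fact.out : 1 ≤ p)).ne'
  have hP : 0 < P := ENNReal.toReal_pos hp0 hp_top
  have hp2 : p / 2 * 2 = p := ENNReal.div_mul_cancel (by norm_num) (by norm_num)
  have hs1 : Fact (1 ≤ p / 2) := ⟨by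
    rw [ENNReal.le_div_iff_mul_le (by norm_num) (by norm_num), one_mul]; exact hp.le⟩
  have hs_top : p / 2 ≠ ∞ := ENNReal.div_ne_top hp_top (by norm_num)
  have hs0 : p / 2 ≠ 0 := (zero_lt_one.trans_le hs1.out).ne'
  have hsP : (p / 2).toReal = P / 2 := by rw [ENNReal.toReal_div]; rfl
  set K : ℝ := 2 * P ^ P * Real.exp (1 / 2) with hK
  have hK0 : 0 < K := by positivity
  set κ : ℝ := (c ^ P / K) ^ (2 / P) with hκ
  have hκ0 : 0 < κ := by positivity
  refine ⟨2 * (2 / κ).toNNReal, fun x hx => ?_⟩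
  have hmem : ∀ n, MemLp (fun ω => x n ω ^ 2) (p / 2) μ := fun n =>
    ⟨(Lp.aestronglyMeasurable (x n)).pow 2, by
      rw [eLpNorm_sq, hp2]
      exact ENNReal.pow_lt_top (Lp.eLpNorm_lt_top (x n))⟩
  let g : ℕ → Lp ℝ (p / 2) μ := fun n => (hmem n).toLp
  have hg : ∀ n, 0 ≤ g n := fun n => by
    rw [← Lp.coeFn_nonneg]
    filter_upwards [(hmem n).coeFn_toLp] with ω hω
    simp only [g]
    rw [hω]
    exact sq_nonneg _
  have hlow : ∀ w : ℕ →₀ ℝ, (∀ n, 0 ≤ w n) → w.sum (fun _ a => a) = 1 →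
      κ ≤ ‖Finsupp.linearCombination ℝ g w‖ := by
    intro w hw hw1
    set F := Finsupp.linearCombination ℝ g w with hF
    have hFae : F =ᵐ[μ] fun ω => ∑ i ∈ w.support, (√(w i) * x i ω) ^ 2 := by
      rw [hF, Finsupp.linearCombination_apply, Finsupp.sum]
      have h1 : ∀ᵐ ω ∂μ, ∀ i, (w i • g i : Lp ℝ (p / 2) μ) ω = w i * x i ω ^ 2 := by
        refine ae_all_iff.2 fun i => ?_
        filter_upwards [Lp.coeFn_smul (w i) (g i), (hmem i).coeFn_toLp] with ω h1 h2
        rw [h1, Pi.smul_apply, h2, smul_eq_mul]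
      filter_upwards [Lp.coeFn_fun_finsetSum w.support fun i => w i • g i, h1] with ω h2 h3
      rw [h2]
      refine Finset.sum_congr rfl fun i _ => ?_
      rw [h3, mul_pow, Real.sq_sqrt (hw i)]
    have hmain := rpow_le_lintegral_square_function (μ := μ) hp0 hp_top w.support
      (fun i ω => √(w i) * x i ω)
      (fun i => (Lp.aestronglyMeasurable (x i)).const_mul _) (c := ENNReal.ofReal c) (by
        intro u hu
        let a : ℕ → ℝ := fun i => if i ∈ u then √(w i) else -√(w i)
        have ha : ∑ i ∈ w.support, a i ^ 2 = 1 := by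
          rw [← hw1, Finsupp.sum]
          refine Finset.sum_congr rfl fun i _ => ?_
          simp only [a]
          split_ifs
          · exact Real.sq_sqrt (hw i)
          · rw [neg_sq]; exact Real.sq_sqrt (hw i)
        have h1 := hx w.support a
        rw [ha, Real.sqrt_one, mul_one] at h1
        have h2 : (∑ i ∈ w.support, a i • x i : Lp ℝ p μ) =ᵐ[μ]
            fun ω => ∑ i ∈ u, √(w i) * x i ω - ∑ i ∈ w.support \ u, √(w i) * x i ω := by
          have h3 : ∀ᵐ ω ∂μ, ∀ i, (a i • x i : Lp ℝ p μ) ω = a i * x i ω := by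
            refine ae_all_iff.2 fun i => ?_
            filter_upwards [Lp.coeFn_smul (a i) (x i)] with ω h1
            rw [h1, Pi.smul_apply, smul_eq_mul]
          filter_upwards [Lp.coeFn_fun_finsetSum w.support fun i => a i • x i, h3] with ω h4 h5
          rw [h4, ← Finset.sum_sdiff hu, add_comm, sub_eq_add_neg, ← Finset.sum_neg_distrib]
          congr 1
          · refine Finset.sum_congr rfl fun i hi => ?_
            rw [h5]
            simp only [a, if_pos hi]
          · refine Finset.sum_congr rfl fun i hi => ?_
            rw [h5]
            simp only [a, if_neg (Finset.mem_sdiff.1 hi).2]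
            ring
        rw [← eLpNorm_congr_ae h2, ← Lp.enorm_def, ← ofReal_norm]
        exact ENNReal.ofReal_le_ofReal h1)
    have hint : ∫⁻ ω, ENNReal.ofReal
        ((∑ i ∈ w.support, (√(w i) * x i ω) ^ 2) ^ (P / 2)) ∂μ =
        ENNReal.ofReal (‖F‖ ^ (P / 2)) := by
      rw [← ENNReal.ofReal_rpow_of_nonneg (norm_nonneg _) (by positivity), ofReal_norm,
        Lp.enorm_def, eLpNorm_eq_lintegral_rpow_enorm_toReal hs0 hs_top, hsP, ← ENNReal.rpow_mul,
        one_div_mul_cancel (by positivity), ENNReal.rpow_one]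
      refine lintegral_congr_ae ?_
      filter_upwards [hFae] with ω hω
      rw [hω, Real.enorm_of_nonneg (Finset.sum_nonneg fun i _ => sq_nonneg _),
        ENNReal.ofReal_rpow_of_nonneg (Finset.sum_nonneg fun i _ => sq_nonneg _) (by positivity)]
    rw [hint, ENNReal.ofReal_rpow_of_nonneg hc.le hP.le, ← ENNReal.ofReal_mul hK0.le,
      ENNReal.ofReal_le_ofReal_iff (by positivity)] at hmain
    have h1 : c ^ P / K ≤ ‖F‖ ^ (P / 2) := by
      rw [div_le_iff₀ hK0, mul_comm]
      exact hmain
    calc κ ≤ (‖F‖ ^ (P / 2)) ^ (2 / P) := Real.rpow_le_rpow (by positivity) h1 (by positivity)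
      _ = ‖F‖ := by
        rw [← Real.rpow_mul (norm_nonneg _)]
        have : P / 2 * (2 / P) = 1 := by field_simp
        rw [this, Real.rpow_one]
  obtain ⟨Ψ, hΨ1, hΨ2, hΨ3⟩ := exists_positive_functional_of_convex_lower_bound g hg hκ0 hlow
  obtain ⟨ρ, hfin, hac, hb, hint⟩ := exists_measure_eq_integral_of_positive hs_top Ψ hΨ1
    (c := (2 / κ).toNNReal) (by rwa [Real.coe_toNNReal _ (by positivity)])
  refine ⟨ρ, hfin, hac, hb, fun n => ?_⟩
  have h1 : (1 : ℝ) ≤ ∫ ω, x n ω ^ 2 ∂ρ := by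
    rw [← integral_congr_ae (hac.ae_eq (hmem n).coeFn_toLp), hint]
    exact hΨ3 n
  have h2 : 1 ≤ eLpNorm (fun ω => x n ω ^ 2) 1 ρ := by
    rw [eLpNorm_one_eq_lintegral_enorm]
    refine le_trans ?_ (enorm_integral_le_lintegral_enorm _)
    rw [Real.enorm_of_nonneg (by linarith), ← ENNReal.ofReal_one]
    exact ENNReal.ofReal_le_ofReal h1
  rw [eLpNorm_sq, one_mul] at h2
  by_contra hlt
  push Not at hlt
  exact absurd h2 (not_le.2 (pow_lt_one₀ zero_le hlt two_ne_zero))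

/-! ### Concentration on disjoint sets -/

/-- A measure whose `L₁` norm is dominated by an `L_s(μ)` norm with `1 < s < ∞` has its density in
the dual Lebesgue space: test the domination on powers of truncations of the density. -/
theorem lintegral_rnDeriv_rpow_le {Ω : Type*} [MeasurableSpace Ω] {μ ρ : Measure Ω}
    [IsFiniteMeasure μ] [IsFiniteMeasure ρ] (hac : ρ ≪ μ) {s : ℝ≥0∞} {r : ℝ} (hs_top : s ≠ ∞)
    (hsr : s.toReal.HolderConjugate r) {C : ℝ≥0}
    (h : ∀ f : Ω → ℝ, AEStronglyMeasurable f μ → eLpNorm f 1 ρ ≤ C * eLpNorm f s μ) :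
    ∫⁻ ω, ρ.rnDeriv μ ω ^ r ∂μ ≤ (C : ℝ≥0∞) ^ r := by
  set d := ρ.rnDeriv μ with hd
  have hdm : Measurable d := Measure.measurable_rnDeriv ρ μ
  have hS : 0 < s.toReal := hsr.pos
  have hs0 : s ≠ 0 := fun h0 => by simp [h0] at hS
  have hr : 0 < r := hsr.symm.pos
  have hr1 : 0 < r - 1 := hsr.symm.sub_one_pos
  have hrS : (r - 1) * s.toReal = r := hsr.symm.sub_one_mul_conj
  -- With `g = min d k`, testing on `g ^ (r - 1)` gives `∫ g ^ r ≤ C (∫ g ^ r) ^ (1 / s)`. The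
  -- integral of `g ^ r` is finite, so that it can be divided out.
  have htrunc : ∀ k : ℕ, ∫⁻ ω, min (d ω) k ^ r ∂μ ≤ (C : ℝ≥0∞) ^ r := by
    intro k
    set a := ∫⁻ ω, min (d ω) k ^ r ∂μ with ha
    have hfin : ∀ ω, min (d ω) (k : ℝ≥0∞) ^ (r - 1) ≠ ∞ := fun ω =>
      ENNReal.rpow_ne_top_of_nonneg hr1.le
        ((min_le_right _ _).trans_lt (ENNReal.natCast_lt_top k)).ne
    have ha_top : a ≠ ∞ := by
      refine ne_top_of_le_ne_top ?_ (lintegral_mono (g := fun _ => (k : ℝ≥0∞) ^ r)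
        fun ω => ENNReal.rpow_le_rpow (min_le_right _ _) hr.le)
      rw [lintegral_const]
      exact ENNReal.mul_ne_top (ENNReal.rpow_ne_top_of_nonneg hr.le (ENNReal.natCast_ne_top k))
        (measure_ne_top μ _)
    have hm : Measurable fun ω => min (d ω) (k : ℝ≥0∞) := hdm.min measurable_const
    let f : Ω → ℝ := fun ω => (min (d ω) (k : ℝ≥0∞) ^ (r - 1)).toReal
    have hf : ∀ ω, ‖f ω‖ₑ = min (d ω) (k : ℝ≥0∞) ^ (r - 1) := fun ω => by
      rw [Real.enorm_of_nonneg ENNReal.toReal_nonneg, ENNReal.ofReal_toReal (hfin ω)]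
    have hf1 : a ≤ eLpNorm f 1 ρ := by
      rw [eLpNorm_one_eq_lintegral_enorm]
      simp_rw [hf]
      rw [← lintegral_rnDeriv_mul hac (hm.pow_const _).aemeasurable]
      refine lintegral_mono fun ω => ?_
      calc min (d ω) (k : ℝ≥0∞) ^ r = min (d ω) (k : ℝ≥0∞) ^ (1 + (r - 1)) := by
            congr 1; ring
        _ = min (d ω) (k : ℝ≥0∞) * min (d ω) (k : ℝ≥0∞) ^ (r - 1) := by
            rw [ENNReal.rpow_add_of_nonneg _ _ zero_le_one hr1.le, ENNReal.rpow_one]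
        _ ≤ d ω * min (d ω) (k : ℝ≥0∞) ^ (r - 1) := by gcongr; exact min_le_left _ _
    have hf2 : eLpNorm f s μ = a ^ (1 / s.toReal) := by
      rw [eLpNorm_eq_lintegral_rpow_enorm_toReal hs0 hs_top]
      simp_rw [hf, ← ENNReal.rpow_mul, hrS]
      rfl
    have hle : a ≤ C * a ^ (1 / s.toReal) :=
      hf1.trans ((h f (hm.pow_const _).ennreal_toReal.aestronglyMeasurable).trans_eq (by rw [hf2]))
    rcases eq_or_ne a 0 with h0 | h0
    · rw [h0]; exact zero_le
    · have hsum : 1 / r + 1 / s.toReal = 1 := by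
        rw [one_div, one_div]
        exact hsr.symm.inv_add_inv_eq_one
      have hmul : a ^ (1 / r) * a ^ (1 / s.toReal) = a := by
        rw [← ENNReal.rpow_add _ _ h0 ha_top, hsum, ENNReal.rpow_one]
      have hb0 : a ^ (1 / s.toReal) ≠ 0 := by
        rw [Ne, ENNReal.rpow_eq_zero_iff_of_pos (by positivity)]; exact h0
      have hbt : a ^ (1 / s.toReal) ≠ ∞ := ENNReal.rpow_ne_top_of_nonneg (by positivity) ha_top
      have h1 : a ^ (1 / r) ≤ C := by
        rw [← ENNReal.mul_le_mul_iff_left hb0 hbt, hmul]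
        exact hle
      calc a = (a ^ (1 / r)) ^ r := by
            rw [← ENNReal.rpow_mul, one_div_mul_cancel hr.ne', ENNReal.rpow_one]
        _ ≤ (C : ℝ≥0∞) ^ r := ENNReal.rpow_le_rpow h1 hr.le
  have hlim : ∀ ω, Tendsto (fun k : ℕ => min (d ω) (k : ℝ≥0∞) ^ r) atTop (𝓝 (d ω ^ r)) := by
    intro ω
    have h1 : Tendsto (fun k : ℕ => min (d ω) (k : ℝ≥0∞)) atTop (𝓝 (min (d ω) ∞)) :=
      tendsto_const_nhds.min ENNReal.tendsto_nat_nhds_top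
    rw [min_top_right] at h1
    exact ((ENNReal.continuous_rpow_const).tendsto _).comp h1
  calc ∫⁻ ω, d ω ^ r ∂μ = ∫⁻ ω, liminf (fun k : ℕ => min (d ω) (k : ℝ≥0∞) ^ r) atTop ∂μ :=
        lintegral_congr fun ω => (hlim ω).liminf_eq.symm
    _ ≤ liminf (fun k : ℕ => ∫⁻ ω, min (d ω) (k : ℝ≥0∞) ^ r ∂μ) atTop :=
        lintegral_liminf_le fun k => (hdm.min measurable_const).pow_const _
    _ ≤ (C : ℝ≥0∞) ^ r := by
        refine liminf_le_of_le (by isBoundedDefault) fun b hb => ?_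
        obtain ⟨k, hk⟩ := hb.exists
        exact hk.trans (htrunc k)

/-- Under the same domination the integrals against `ρ` of the unit ball of `L_s(μ)` are uniformly
absolutely continuous. -/
theorem exists_pos_eLpNorm_restrict_le {Ω : Type*} [MeasurableSpace Ω] {μ ρ : Measure Ω}
    [IsFiniteMeasure μ] [IsFiniteMeasure ρ] (hac : ρ ≪ μ) {s : ℝ≥0∞} (hs : 1 < s) (hs_top : s ≠ ∞)
    {C : ℝ≥0}
    (h : ∀ f : Ω → ℝ, AEStronglyMeasurable f μ → eLpNorm f 1 ρ ≤ C * eLpNorm f s μ)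
    {ε : ℝ≥0∞} (hε : ε ≠ 0) :
    ∃ η : ℝ≥0∞, 0 < η ∧ ∀ G : Set Ω, MeasurableSet G → μ G ≤ η →
      ∀ f : Ω → ℝ, AEStronglyMeasurable f μ →
        eLpNorm f 1 (ρ.restrict G) ≤ ε * eLpNorm f s μ := by
  have hS1 : 1 < s.toReal := by
    rw [← ENNReal.toReal_one]
    exact (ENNReal.toReal_lt_toReal ENNReal.one_ne_top hs_top).2 hs
  have hsr := Real.HolderConjugate.conjExponent hS1
  set r := Real.conjExponent s.toReal
  have hr : 0 < r := hsr.symm.pos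
  have hs0 : s ≠ 0 := (zero_lt_one.trans hs).ne'
  have hint := lintegral_rnDeriv_rpow_le hac hs_top hsr h
  obtain ⟨δ, hδ, hsmall⟩ := exists_pos_setLIntegral_lt_of_measure_lt
    (hint.trans_lt (ENNReal.rpow_lt_top_of_nonneg hr.le ENNReal.coe_ne_top)).ne
    (ε := ε ^ r) (by rw [Ne, ENNReal.rpow_eq_zero_iff_of_pos hr]; exact hε)
  obtain ⟨η, hη0, hηδ⟩ := exists_between hδ
  refine ⟨η, hη0, fun G hG hμG f hf => ?_⟩
  have hG1 := hsmall G (hμG.trans_lt hηδ)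
  have hdm : Measurable (ρ.rnDeriv μ) := Measure.measurable_rnDeriv ρ μ
  rw [eLpNorm_one_eq_lintegral_enorm, ← Measure.withDensity_rnDeriv_eq ρ μ hac,
    restrict_withDensity hG,
    lintegral_withDensity_eq_lintegral_mul₀ hdm.aemeasurable hf.enorm.restrict]
  refine (ENNReal.lintegral_mul_le_Lp_mul_Lq (μ.restrict G) hsr.symm hdm.aemeasurable
    hf.enorm.restrict).trans ?_
  gcongr
  · rw [one_div]
    refine (ENNReal.rpow_inv_le_iff hr).2 hG1.le
  · rw [eLpNorm_eq_lintegral_rpow_enorm_toReal hs0 hs_top]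
    gcongr
    exact Measure.restrict_le_self

/-- Concentration of a subsequence on disjoint sets. The integrals of `Y m n` against `ρ m` are
bounded below although those against `μ` tend to zero; so they come from the set where the density
of `ρ m` is large, which has small `μ`-measure. -/
theorem exists_disjoint_sets_of_tendsto_zero {Ω : Type*} [MeasurableSpace Ω] {μ : Measure Ω}
    [IsFiniteMeasure μ] (ρ : ℕ → Measure Ω) [∀ m, IsFiniteMeasure (ρ m)] (hac : ∀ m, ρ m ≪ μ)
    {C : ℝ≥0∞} (hC : C ≠ ∞) (hρ : ∀ m, ρ m Set.univ ≤ C)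
    (Y : ℕ → ℕ → Ω → ℝ≥0∞) (hY : ∀ m n, AEMeasurable (Y m n) μ)
    (hlow : ∀ m n, 1 ≤ ∫⁻ ω, Y m n ω ∂(ρ m))
    (hsmall : ∀ ε : ℝ≥0∞, 0 < ε → ∀ᶠ m in atTop, ∀ n, ∫⁻ ω, Y m n ω ∂μ ≤ ε)
    (huac : ∀ m, ∃ η : ℝ≥0∞, 0 < η ∧ ∀ G : Set Ω, MeasurableSet G → μ G ≤ η →
      ∀ n, ∫⁻ ω in G, Y m n ω ∂(ρ m) ≤ 4⁻¹) :
    ∃ (m : ℕ → ℕ) (A : ℕ → Set Ω), Function.Injective m ∧ (∀ k, MeasurableSet (A k)) ∧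
      Pairwise (Function.onFun Disjoint A) ∧
      ∀ k n, 2⁻¹ ≤ ∫⁻ ω in A k, Y (m k) n ω ∂(ρ (m k)) := by
  have key := exists_seq_of_forall_initial (α := ℕ × Set Ω × ℝ≥0∞)
    (P := fun _ x => MeasurableSet x.2.1 ∧ 0 < x.2.2 ∧
      (∀ n, ∫⁻ ω in x.2.1ᶜ, Y x.1 n ω ∂(ρ x.1) ≤ 4⁻¹) ∧
      ∀ G : Set Ω, MeasurableSet G → μ G ≤ x.2.2 → ∀ n, ∫⁻ ω in G, Y x.1 n ω ∂(ρ x.1) ≤ 4⁻¹)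
    (r := fun _ j x y => x.1 < y.1 ∧ μ y.2.1 ≤ x.2.2 * 2⁻¹ ^ (j + 1)) ?_
  · obtain ⟨x, hx, hr⟩ := key
    -- a set of the subsequence loses its intersections with all later ones, which are negligible
    -- for its measure by uniform absolute continuity
    have hmono : StrictMono fun k => (x k).1 := fun i j hij => (hr i j hij).1
    let G : ℕ → Set Ω := fun k => ⋃ j, ⋃ (_ : k < j), (x j).2.1
    have hG : ∀ k, MeasurableSet (G k) := fun k =>
      MeasurableSet.iUnion fun j => MeasurableSet.iUnion fun _ => (hx j).1
    have hμG : ∀ k, μ (G k) ≤ (x k).2.2 := by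
      intro k
      calc μ (G k) ≤ ∑' j, μ (⋃ (_ : k < j), (x j).2.1) := measure_iUnion_le _
        _ ≤ ∑' j, (x k).2.2 * 2⁻¹ ^ (j + 1) := by
            refine ENNReal.tsum_le_tsum fun j => ?_
            by_cases hkj : k < j
            · simp only [hkj, Set.iUnion_true]
              exact (hr k j hkj).2
            · simp [hkj]
        _ = (x k).2.2 := by
            rw [ENNReal.tsum_mul_left, ENNReal.tsum_geometric_add_one, ENNReal.one_sub_inv_two,
              inv_inv, ENNReal.inv_mul_cancel (by norm_num) (by norm_num), mul_one]
    refine ⟨fun k => (x k).1, fun k => (x k).2.1 \ G k, hmono.injective,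
      fun k => (hx k).1.diff (hG k), ?_, fun k n => ?_⟩
    · have hlt : ∀ i j, i < j → Disjoint ((x i).2.1 \ G i) ((x j).2.1 \ G j) := by
        intro i j hij
        rw [Set.disjoint_left]
        rintro ω ⟨_, hω⟩ ⟨hω', _⟩
        exact hω (Set.mem_iUnion₂.2 ⟨j, hij, hω'⟩)
      intro i j hij
      rcases lt_or_gt_of_ne hij with h | h
      · exact hlt i j h
      · exact (hlt j i h).symm
    · obtain ⟨_, _, h3, h4⟩ := hx k
      have hcompl : ((x k).2.1 \ G k)ᶜ ⊆ (x k).2.1ᶜ ∪ G k := by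
        intro ω hω
        by_cases h : ω ∈ G k
        · exact Or.inr h
        · exact Or.inl fun h' => hω ⟨h', h⟩
      have hle : ∫⁻ ω in ((x k).2.1 \ G k)ᶜ, Y (x k).1 n ω ∂(ρ (x k).1) ≤ 2⁻¹ := by
        calc _ ≤ ∫⁻ ω in (x k).2.1ᶜ ∪ G k, Y (x k).1 n ω ∂(ρ (x k).1) := lintegral_mono_set hcompl
          _ ≤ _ := lintegral_union_le _ _ _
          _ ≤ 4⁻¹ + 4⁻¹ := add_le_add (h3 n) (h4 (G k) (hG k) (hμG k) n)
          _ = 2⁻¹ := by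
            rw [← two_mul, show (4 : ℝ≥0∞) = 2 * 2 by norm_num,
              ENNReal.mul_inv (by norm_num) (by norm_num), ← mul_assoc,
              ENNReal.mul_inv_cancel (by norm_num) (by norm_num), one_mul]
      have hsum := hlow (x k).1 n
      rw [← lintegral_add_compl _ ((hx k).1.diff (hG k))] at hsum
      have h5 : (1 : ℝ≥0∞) ≤ _ + 2⁻¹ := hsum.trans (add_le_add_right hle _)
      rw [← ENNReal.one_sub_inv_two]
      exact tsub_le_iff_right.2 h5
  · intro j v hv
    set ε := (Finset.range j).inf fun i => (v i).2.2 * 2⁻¹ ^ (j + 1) with hεdef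
    have hε : 0 < ε := by
      rw [hεdef, Finset.lt_inf_iff (by simp)]
      intro i hi
      exact ENNReal.mul_pos (hv i (Finset.mem_range.1 hi)).2.1.ne'
        (pow_ne_zero _ (ENNReal.inv_ne_zero.2 (by norm_num)))
    -- `K` is so large that the density exceeds it on a set of `μ`-measure at most `ε` only
    obtain ⟨K, hK⟩ := ENNReal.exists_nat_mul_gt hε.ne' hC
    have hK0 : (K : ℝ≥0∞) ≠ 0 := by
      rintro h0
      rw [h0, zero_mul] at hK
      exact absurd hK not_lt_zero
    have hpos : 0 < (4 : ℝ≥0∞)⁻¹ * (K : ℝ≥0∞)⁻¹ :=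
      ENNReal.mul_pos (ENNReal.inv_ne_zero.2 (by norm_num))
        (ENNReal.inv_ne_zero.2 (ENNReal.natCast_ne_top K))
    have hev : ∀ᶠ m in atTop, ∀ i ∈ Finset.range j, (v i).1 < m :=
      (Filter.eventually_all_finset _).2 fun i _ => eventually_gt_atTop _
    obtain ⟨m, hm1, hm2⟩ := ((hsmall _ hpos).and hev).exists
    obtain ⟨η, hη, hη'⟩ := huac m
    have hdm : Measurable ((ρ m).rnDeriv μ) := Measure.measurable_rnDeriv _ μ
    let B : Set Ω := {ω | (K : ℝ≥0∞) ≤ (ρ m).rnDeriv μ ω}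
    have hB : MeasurableSet B := measurableSet_le measurable_const hdm
    have hμB : μ B ≤ ε := by
      have h1 := mul_meas_ge_le_lintegral (μ := μ) hdm (K : ℝ≥0∞)
      have h2 : ∫⁻ ω, (ρ m).rnDeriv μ ω ∂μ ≤ K * ε := by
        rw [Measure.lintegral_rnDeriv (hac m)]
        exact (hρ m).trans hK.le
      exact (ENNReal.mul_le_mul_iff_right hK0 (ENNReal.natCast_ne_top K)).1 (h1.trans h2)
    refine ⟨(m, B, η), ⟨hB, hη, fun n => ?_, hη'⟩, fun i hi => ⟨hm2 i (Finset.mem_range.2 hi), ?_⟩⟩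
    · calc ∫⁻ ω in Bᶜ, Y m n ω ∂(ρ m)
          = ∫⁻ ω in Bᶜ, (ρ m).rnDeriv μ ω * Y m n ω ∂μ := by
            conv_lhs => rw [← Measure.withDensity_rnDeriv_eq (ρ m) μ (hac m)]
            rw [restrict_withDensity hB.compl,
              lintegral_withDensity_eq_lintegral_mul₀ hdm.aemeasurable (hY m n).restrict]
            rfl
        _ ≤ ∫⁻ ω in Bᶜ, (K : ℝ≥0∞) * Y m n ω ∂μ := by
            refine setLIntegral_mono_ae ((hY m n).const_mul _).restrict ?_
            refine ae_of_all _ fun ω hω => ?_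
            gcongr
            exact (lt_of_not_ge (fun hle => hω hle)).le
        _ ≤ ∫⁻ ω, (K : ℝ≥0∞) * Y m n ω ∂μ := setLIntegral_le_lintegral _ _
        _ = K * ∫⁻ ω, Y m n ω ∂μ := lintegral_const_mul' _ _ (ENNReal.natCast_ne_top K)
        _ ≤ K * (4⁻¹ * (K : ℝ≥0∞)⁻¹) := by gcongr; exact hm1 n
        _ = 4⁻¹ := by
            rw [mul_comm, mul_assoc, ENNReal.inv_mul_cancel hK0 (ENNReal.natCast_ne_top K), mul_one]
    · exact hμB.trans (Finset.inf_le (Finset.mem_range.2 hi))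

/-- Some choice of signs makes a sum at least as long as an orthogonal one (parallelogram law). -/
theorem exists_signs_sum_norm_sq_le {H : Type*} [NormedAddCommGroup H] [InnerProductSpace ℝ H]
    {ι : Type*} [DecidableEq ι] (t : Finset ι) (x : ι → H) :
    ∃ ε : ι → ℝ, (∀ i, |ε i| = 1) ∧ ∑ i ∈ t, ‖x i‖ ^ 2 ≤ ‖∑ i ∈ t, ε i • x i‖ ^ 2 := by
  induction t using Finset.induction_on with
  | empty => exact ⟨fun _ => 1, fun _ => abs_one, by simp⟩
  | insert a t ha ih =>
    obtain ⟨ε, hε, hle⟩ := ih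
    set S := ∑ i ∈ t, ε i • x i with hS
    have hpar := parallelogram_law_with_norm ℝ S (x a)
    have hupd : ∀ b : ℝ, ∑ i ∈ t, Function.update ε a b i • x i = S := fun b =>
      Finset.sum_congr rfl fun i hi => by
        rw [Function.update_of_ne (ne_of_mem_of_not_mem hi ha)]
    have hside : ∃ b : ℝ, |b| = 1 ∧ ‖S‖ ^ 2 + ‖x a‖ ^ 2 ≤ ‖S + b • x a‖ ^ 2 := by
      by_cases h : ‖S‖ ^ 2 + ‖x a‖ ^ 2 ≤ ‖S + x a‖ ^ 2
      · exact ⟨1, abs_one, by rwa [one_smul]⟩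
      · refine ⟨-1, by simp, ?_⟩
        rw [neg_one_smul, ← sub_eq_add_neg]
        nlinarith
    obtain ⟨b, hb, hb'⟩ := hside
    refine ⟨Function.update ε a b, fun i => ?_, ?_⟩
    · by_cases h : i = a
      · subst h; rwa [Function.update_self]
      · rw [Function.update_of_ne h]; exact hε i
    · rw [Finset.sum_insert ha, Finset.sum_insert ha, hupd, Function.update_self, add_comm,
        add_comm (b • x a)]
      linarith

/-- An operator from `ℓ_p(ℓ₂)`, `p > 2`, to a Hilbert space is small on all but finitely many
summands: vectors `u_i` from `N` summands have signed sums of norm at most `N ^ (1 / p)`, whereas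
a suitable signed sum of the images is at least as large as an orthogonal one. -/
theorem eventually_norm_summand_le {p : ℝ≥0∞} [Fact (1 ≤ p)] (hp : 2 < p) (hp_top : p ≠ ∞)
    {H : Type*} [NormedAddCommGroup H] [InnerProductSpace ℝ H] (A : EllpEllTwo p →L[ℝ] H)
    {ε : ℝ} (hε : 0 < ε) :
    ∀ᶠ m in atTop, ∀ u : EllTwo, ‖u‖ ≤ 1 → ‖A (summand p m u)‖ ≤ ε := by
  classical
  set P := p.toReal with hPdef
  have hP2 : 2 < P := by
    rw [hPdef, ← ENNReal.toReal_ofNat 2]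
    exact (ENNReal.toReal_lt_toReal (by norm_num) hp_top).2 hp
  have hP : 0 < P := by linarith
  by_contra hcon
  rw [Filter.not_eventually] at hcon
  have hinf := Nat.frequently_atTop_iff_infinite.1 hcon
  have hexp : 0 < 1 - 2 / P := by
    rw [sub_pos, div_lt_one hP]; exact hP2
  have hlim := ((_root_.tendsto_rpow_atTop hexp).comp
    tendsto_natCast_atTop_atTop).eventually_gt_atTop (‖A‖ ^ 2 / ε ^ 2)
  obtain ⟨N, hN, hN0⟩ := (hlim.and (eventually_gt_atTop 0)).exists
  simp only [Function.comp_apply] at hN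
  have hNpos : (0 : ℝ) < N := Nat.cast_pos.2 hN0
  obtain ⟨t, ht, hcard⟩ := hinf.exists_subset_card_eq N
  have hex : ∀ m, ∃ u : EllTwo, ‖u‖ ≤ 1 ∧ (m ∈ t → ε < ‖A (summand p m u)‖) := by
    intro m
    by_cases hm : m ∈ t
    · have := ht hm
      simp only [Set.mem_ofPred_eq] at this
      push Not at this
      obtain ⟨u, hu1, hu2⟩ := this
      exact ⟨u, hu1, fun _ => hu2⟩
    · exact ⟨0, by simp, fun h => absurd h hm⟩
  choose u hu1 hu2 using hex
  obtain ⟨σ, hσ, hle⟩ := exists_signs_sum_norm_sq_le t fun m => A (summand p m (u m))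
  have hvec : ∑ m ∈ t, σ m • A (summand p m (u m)) =
      A (∑ m ∈ t, lp.single p m (σ m • u m)) := by
    rw [map_sum]
    refine Finset.sum_congr rfl fun m _ => ?_
    rw [← summand_apply, map_smul, map_smul]
  have hnorm : ‖(∑ m ∈ t, lp.single p m (σ m • u m) : EllpEllTwo p)‖ ≤ (N : ℝ) ^ (1 / P) := by
    have h1 := lp.norm_sum_single (E := fun _ : ℕ => EllTwo) hP (fun m => σ m • u m) t
    have h2 : ‖(∑ m ∈ t, lp.single p m (σ m • u m) : EllpEllTwo p)‖ ^ P ≤ N := by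
      rw [h1, ← hcard, ← nsmul_one, ← Finset.sum_const]
      refine Finset.sum_le_sum fun m _ => ?_
      refine Real.rpow_le_one (norm_nonneg _) ?_ hP.le
      rw [norm_smul, Real.norm_eq_abs, hσ, one_mul]
      exact hu1 m
    calc _ = (‖(∑ m ∈ t, lp.single p m (σ m • u m) : EllpEllTwo p)‖ ^ P) ^ (1 / P) := by
          rw [← Real.rpow_mul (norm_nonneg _), mul_one_div_cancel hP.ne', Real.rpow_one]
      _ ≤ _ := Real.rpow_le_rpow (by positivity) h2 (by positivity)
  have hup : ‖∑ m ∈ t, σ m • A (summand p m (u m))‖ ^ 2 ≤ ‖A‖ ^ 2 * (N : ℝ) ^ (2 / P) := by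
    rw [hvec]
    calc _ ≤ (‖A‖ * (N : ℝ) ^ (1 / P)) ^ 2 := by
          refine pow_le_pow_left₀ (norm_nonneg _) ((A.le_opNorm _).trans ?_) 2
          gcongr
      _ = ‖A‖ ^ 2 * (N : ℝ) ^ (2 / P) := by
          rw [mul_pow, ← Real.rpow_natCast ((N : ℝ) ^ (1 / P)), ← Real.rpow_mul hNpos.le,
            Nat.cast_ofNat, one_div_mul_eq_div]
  have hlow : (N : ℝ) * ε ^ 2 ≤ ∑ m ∈ t, ‖A (summand p m (u m))‖ ^ 2 := by
    rw [← hcard, ← nsmul_eq_mul, ← Finset.sum_const]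
    exact Finset.sum_le_sum fun m hm => pow_le_pow_left₀ hε.le (hu2 m hm).le 2
  have hfinal := hlow.trans (hle.trans hup)
  have hsplit : (N : ℝ) = (N : ℝ) ^ (1 - 2 / P) * (N : ℝ) ^ (2 / P) := by
    rw [← Real.rpow_add hNpos, sub_add_cancel, Real.rpow_one]
  rw [div_lt_iff₀ (by positivity)] at hN
  have hpow : 0 < (N : ℝ) ^ (2 / P) := Real.rpow_pos_of_pos hNpos _
  have h3 := mul_lt_mul_of_pos_right hN hpow
  have h4 : (N : ℝ) * ε ^ 2 = (N : ℝ) ^ (1 - 2 / P) * ε ^ 2 * (N : ℝ) ^ (2 / P) := by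
    conv_lhs => rw [hsplit]
    ring
  linarith

/-! ### Left inverses of embeddings of `ℓ_p(ℓ₂)` -/

theorem norm_sum_smul_ellTwoUnit (t : Finset ℕ) (a : ℕ → ℝ) :
    ‖∑ i ∈ t, a i • ellTwoUnit i‖ = √(∑ i ∈ t, a i ^ 2) := by
  have h := lp.norm_sum_single (E := fun _ : ℕ => ℝ) (p := 2) (by norm_num) a t
  simp only [ENNReal.toReal_ofNat, Real.rpow_two, Real.norm_eq_abs, sq_abs] at h
  have e : ∑ i ∈ t, a i • ellTwoUnit i = ∑ i ∈ t, lp.single (E := fun _ : ℕ => ℝ) 2 i (a i) :=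
    Finset.sum_congr rfl fun i _ => by
      rw [ellTwoUnit, ← lp.single_smul, smul_eq_mul, mul_one]
  rw [e, ← h, Real.sqrt_sq (norm_nonneg _)]

theorem eLpNorm_two_restrict_le {Ω : Type*} [MeasurableSpace Ω] {μ ρ : Measure Ω} {p : ℝ≥0∞}
    {C : ℝ≥0} (h : ∀ f : Ω → ℝ, AEStronglyMeasurable f μ → eLpNorm f 1 ρ ≤ C * eLpNorm f (p / 2) μ)
    {A : Set Ω} (hA : MeasurableSet A) {f : Ω → ℝ} (hf : AEStronglyMeasurable f μ) :
    eLpNorm f 2 (ρ.restrict A) ≤ NNReal.sqrt C * eLpNorm f p (μ.restrict A) := by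
  have hp2 : p / 2 * 2 = p := ENNReal.div_mul_cancel (by norm_num) (by norm_num)
  have h1 := h (A.indicator fun ω => f ω ^ 2) ((hf.pow 2).indicator hA)
  rw [eLpNorm_indicator_eq_eLpNorm_restrict hA, eLpNorm_indicator_eq_eLpNorm_restrict hA,
    eLpNorm_sq, eLpNorm_sq, one_mul, hp2] at h1
  refine (ENNReal.pow_le_pow_left_iff two_ne_zero).1 ?_
  rw [mul_pow, ← ENNReal.coe_pow, NNReal.sq_sqrt]
  exact h1

theorem sum_eLpNorm_restrict_rpow_le {Ω : Type*} [MeasurableSpace Ω] {μ : Measure Ω} {p : ℝ≥0∞}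
    (hp0 : p ≠ 0) (hp_top : p ≠ ∞) {A : ℕ → Set Ω} (hA : ∀ k, MeasurableSet (A k))
    (hd : Pairwise (Function.onFun Disjoint A)) (f : Ω → ℝ) (t : Finset ℕ) :
    ∑ k ∈ t, eLpNorm f p (μ.restrict (A k)) ^ p.toReal ≤ eLpNorm f p μ ^ p.toReal := by
  have hP : 0 < p.toReal := ENNReal.toReal_pos hp0 hp_top
  have e : ∀ ν : Measure Ω, eLpNorm f p ν ^ p.toReal = ∫⁻ ω, ‖f ω‖ₑ ^ p.toReal ∂ν := fun ν => by
    rw [eLpNorm_eq_lintegral_rpow_enorm_toReal hp0 hp_top, ← ENNReal.rpow_mul,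
      one_div_mul_cancel hP.ne', ENNReal.rpow_one]
  simp_rw [e]
  rw [← lintegral_biUnion_finset (fun i _ j _ hij => hd hij) (fun k _ => hA k)]
  exact setLIntegral_le_lintegral _ _

/-- For `2 < p < ∞`, every isomorphic embedding of `ℓ_p(ℓ₂)` into `L_p` has, after composition with
an embedding of `ℓ_p(ℓ₂)` into itself, a bounded left inverse. -/
theorem exists_leftInverse_comp {Ω : Type*} [MeasurableSpace Ω] (μ : Measure Ω)
    [IsProbabilityMeasure μ] {p : ℝ≥0∞} [Fact (1 ≤ p)] (hp : 2 < p) (hp_top : p ≠ ∞)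
    (T : EllpEllTwo p →L[ℝ] Lp ℝ p μ) {c : ℝ} (hc : 0 < c) (hT : ∀ a, c * ‖a‖ ≤ ‖T a‖) :
    ∃ (U : EllpEllTwo p →L[ℝ] EllpEllTwo p) (Q : Lp ℝ p μ →L[ℝ] EllpEllTwo p),
      Q.comp (T.comp U) = ContinuousLinearMap.id ℝ _ := by
  have hp0 : p ≠ 0 := (zero_lt_one.trans_le (Fact.out : 1 ≤ p)).ne'
  have hP : 0 < p.toReal := ENNReal.toReal_pos hp0 hp_top
  have hs1 : 1 < p / 2 := by
    rw [ENNReal.lt_div_iff_mul_lt (by norm_num) (by norm_num), one_mul]; exact hp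
  have hs_top : p / 2 ≠ ∞ := ENNReal.div_ne_top hp_top (by norm_num)
  have hp2 : p / 2 * 2 = p := ENNReal.div_mul_cancel (by norm_num) (by norm_num)
  let x : ℕ → ℕ → Lp ℝ p μ := fun m n => T (summand p m (ellTwoUnit n))
  obtain ⟨C, hC⟩ := exists_measure_of_dominates_ellTwo μ hp hp_top hc
  have hex : ∀ m, ∃ ρ : Measure Ω, IsFiniteMeasure ρ ∧ ρ ≪ μ ∧
      (∀ f : Ω → ℝ, AEStronglyMeasurable f μ → eLpNorm f 1 ρ ≤ C * eLpNorm f (p / 2) μ) ∧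
      ∀ n, 1 ≤ eLpNorm (x m n) 2 ρ := by
    intro m
    refine hC (x m) fun t a => ?_
    have e : ∑ i ∈ t, a i • x m i = T (summand p m (∑ i ∈ t, a i • ellTwoUnit i)) := by
      simp only [map_sum, map_smul, x]
    rw [e, ← norm_sum_smul_ellTwoUnit]
    refine le_trans (le_of_eq ?_) (hT _)
    rw [summand_apply, lp.norm_single (zero_lt_iff.2 hp0)]
  choose ρ hfin hac hb hlow using hex
  have hsq : ∀ (f : Ω → ℝ) (ν : Measure Ω), ∫⁻ ω, ‖f ω ^ 2‖ₑ ∂ν = eLpNorm f 2 ν ^ 2 := by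
    intro f ν
    rw [← eLpNorm_one_eq_lintegral_enorm, eLpNorm_sq, one_mul]
  have hxmeas : ∀ m n, AEStronglyMeasurable (fun ω => x m n ω ^ 2) μ := fun m n =>
    (Lp.aestronglyMeasurable (x m n)).pow 2
  -- through the inclusion of `L_p(μ)` into `L₂(μ)`, late summands are small in `L₂(μ)`
  obtain ⟨I, hI⟩ := exists_inclusion_Lp (μ := μ) (ρ := μ) (p := p) (q := 2) (c := 1)
    Measure.AbsolutelyContinuous.rfl (fun f hf => by
      rw [ENNReal.coe_one, one_mul]
      exact eLpNorm_le_eLpNorm_of_exponent_le hp.le hf)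
  have hIx : ∀ m n, eLpNorm (x m n) 2 μ = ENNReal.ofReal ‖I (x m n)‖ := fun m n => by
    rw [ofReal_norm, Lp.enorm_def, eLpNorm_congr_ae (hI (x m n))]
  obtain ⟨m, A, hm, hA, hd, hAlow⟩ := exists_disjoint_sets_of_tendsto_zero (μ := μ) ρ hac
    (C := C) ENNReal.coe_ne_top (fun m => by
      have h := hb m (fun _ => 1) aestronglyMeasurable_const
      rw [eLpNorm_one_eq_lintegral_enorm] at h
      simpa [eLpNorm_const' (μ := μ) (1 : ℝ) (zero_lt_one.trans hs1).ne' hs_top] using h)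
    (fun m n ω => ‖x m n ω ^ 2‖ₑ) (fun m n => (hxmeas m n).enorm)
    (fun m n => by
      rw [hsq]
      exact one_le_pow₀ (hlow m n))
    (fun ε hε => by
      obtain ⟨δ, hδ0, hδε⟩ : ∃ δ : ℝ, 0 < δ ∧ ENNReal.ofReal (δ ^ 2) ≤ ε := by
        obtain ⟨η, hη0, hη⟩ := ENNReal.lt_iff_exists_nnreal_btwn.1 hε
        refine ⟨√η, Real.sqrt_pos.2 (by exact_mod_cast hη0), ?_⟩
        rw [Real.sq_sqrt η.coe_nonneg, ENNReal.ofReal_coe_nnreal]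
        exact hη.le
      filter_upwards [eventually_norm_summand_le hp hp_top (I.comp T) hδ0] with m hm n
      rw [hsq, hIx, ← ENNReal.ofReal_pow (norm_nonneg _)]
      refine (ENNReal.ofReal_le_ofReal ?_).trans hδε
      exact pow_le_pow_left₀ (norm_nonneg _) (hm _ (norm_ellTwoUnit n).le) 2)
    (fun m => by
      -- the functions `(x m n) ^ 2` are bounded in `L_{p/2}` by `‖T‖ ^ 2`
      set D : ℝ≥0∞ := ENNReal.ofReal (‖T‖ ^ 2) + 1 with hD
      have hD0 : D ≠ 0 := by simp [hD]
      have hDt : D ≠ ∞ := by simp [hD]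
      obtain ⟨η, hη, h⟩ := exists_pos_eLpNorm_restrict_le (hac m) hs1 hs_top (hb m)
        (ε := 4⁻¹ * D⁻¹) (mul_ne_zero (by simp) (ENNReal.inv_ne_zero.2 hDt))
      refine ⟨η, hη, fun G hG hμG n => ?_⟩
      have h1 := h G hG hμG _ (hxmeas m n)
      rw [eLpNorm_one_eq_lintegral_enorm] at h1
      refine h1.trans ?_
      have h2 : eLpNorm (fun ω => x m n ω ^ 2) (p / 2) μ ≤ D := by
        rw [eLpNorm_sq, hp2, ← Lp.enorm_def, ← ofReal_norm, ← ENNReal.ofReal_pow (norm_nonneg _)]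
        refine le_trans (ENNReal.ofReal_le_ofReal (pow_le_pow_left₀ (norm_nonneg _) ?_ 2))
          le_self_add
        refine (T.le_opNorm _).trans ?_
        rw [summand_apply, lp.norm_single (zero_lt_iff.2 hp0), norm_ellTwoUnit, mul_one]
      calc 4⁻¹ * D⁻¹ * _ ≤ 4⁻¹ * D⁻¹ * D := by gcongr
        _ = 4⁻¹ := by rw [mul_assoc, ENNReal.inv_mul_cancel hD0 hDt, mul_one])
  have hres : ∀ k (f : Ω → ℝ), AEStronglyMeasurable f μ →
      eLpNorm f 2 ((ρ (m k)).restrict (A k)) ≤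
        NNReal.sqrt C * eLpNorm f p (μ.restrict (A k)) := fun k f hf =>
    eLpNorm_two_restrict_le (hb (m k)) (hA k) hf
  have hJex : ∀ k, ∃ J : Lp ℝ p μ →L[ℝ] Lp ℝ 2 ((ρ (m k)).restrict (A k)),
      ∀ f, J f =ᵐ[(ρ (m k)).restrict (A k)] f := fun k =>
    exists_inclusion_Lp (c := NNReal.sqrt C)
      (Measure.absolutelyContinuous_of_le Measure.restrict_le_self |>.trans (hac (m k)))
      (fun f hf => (hres k f hf).trans (by gcongr; exact Measure.restrict_le_self))
  choose J hJ using hJex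
  have hJnorm : ∀ k f, ENNReal.ofReal ‖J k f‖ = eLpNorm f 2 ((ρ (m k)).restrict (A k)) :=
    fun k f => by rw [ofReal_norm, Lp.enorm_def, eLpNorm_congr_ae (hJ k f)]
  refine exists_factorization_of_hilbert_maps hp_top J (C := NNReal.sqrt C) (by positivity) ?_ T hm
    (δ := √(1 / 2)) (by positivity) fun k n => ?_
  · intro f t
    rw [← ENNReal.ofReal_le_ofReal_iff (by positivity),
      ENNReal.ofReal_sum_of_nonneg (fun k _ => by positivity)]
    calc ∑ k ∈ t, ENNReal.ofReal (‖J k f‖ ^ p.toReal)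
        ≤ ∑ k ∈ t, (NNReal.sqrt C : ℝ≥0∞) ^ p.toReal *
            eLpNorm f p (μ.restrict (A k)) ^ p.toReal := by
          refine Finset.sum_le_sum fun k _ => ?_
          rw [← ENNReal.ofReal_rpow_of_nonneg (norm_nonneg _) hP.le, hJnorm,
            ← ENNReal.mul_rpow_of_nonneg _ _ hP.le]
          exact ENNReal.rpow_le_rpow (hres k f (Lp.aestronglyMeasurable f)) hP.le
      _ ≤ (NNReal.sqrt C : ℝ≥0∞) ^ p.toReal * eLpNorm f p μ ^ p.toReal := by
          rw [← Finset.mul_sum]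
          gcongr
          exact sum_eLpNorm_restrict_rpow_le hp0 hp_top hA hd f t
      _ = ENNReal.ofReal ((NNReal.sqrt C * ‖f‖) ^ p.toReal) := by
          rw [← ENNReal.mul_rpow_of_nonneg _ _ hP.le,
            ← ENNReal.ofReal_rpow_of_nonneg (by positivity) hP.le,
            ENNReal.ofReal_mul (by positivity), ofReal_norm, Lp.enorm_def,
            ENNReal.ofReal_coe_nnreal]
  · have h1 := hAlow k n
    rw [hsq, ← hJnorm, ← ENNReal.ofReal_pow (norm_nonneg _)] at h1
    have h2 : ENNReal.ofReal (1 / 2) ≤ ENNReal.ofReal (‖J k (x (m k) n)‖ ^ 2) := by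
      refine le_trans (le_of_eq ?_) h1
      rw [one_div, ENNReal.ofReal_inv_of_pos (by norm_num)]
      norm_num
    rw [ENNReal.ofReal_le_ofReal_iff (by positivity)] at h2
    exact Real.sqrt_le_iff.2 ⟨norm_nonneg _, h2⟩

/-- The range of an operator with a bounded left inverse is isomorphic to its domain and
complemented. -/
theorem closedComplemented_range_of_leftInverse {E F : Type*} [NormedAddCommGroup E]
    [NormedSpace ℝ E] [NormedAddCommGroup F] [NormedSpace ℝ F] (S : F →L[ℝ] E) (Q : E →L[ℝ] F)
    (h : Q.comp S = ContinuousLinearMap.id ℝ F) :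
    Nonempty (LinearMap.range (S : F →ₗ[ℝ] E) ≃L[ℝ] F) ∧
      (LinearMap.range (S : F →ₗ[ℝ] E)).ClosedComplemented := by
  have hQS : ∀ a, Q (S a) = a := fun a => congrArg (fun R : F →L[ℝ] F => R a) h
  let S' : F →L[ℝ] LinearMap.range (S : F →ₗ[ℝ] E) := S.codRestrict _ fun a => ⟨a, rfl⟩
  have hS' : ∀ y : LinearMap.range (S : F →ₗ[ℝ] E), S' (Q y) = y := by
    rintro ⟨_, a, rfl⟩
    exact Subtype.ext (congrArg S (hQS a))
  exact ⟨⟨ContinuousLinearEquiv.equivOfInverse (Q.comp (Submodule.subtypeL _)) S' hS' hQS⟩,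
    S'.comp Q, hS'⟩

theorem mainTheorem8 {Ω : Type*} [MeasurableSpace Ω] (μ : Measure Ω) [IsProbabilityMeasure μ]
    (hatomless : AtomlessMeasure μ) (hsep : IsSeparable μ)
    (p : ℝ≥0∞) [Fact (1 ≤ p)] (hp : 2 < p) (hp_top : p ≠ ∞)
    (X : Submodule ℝ (Lp ℝ p μ)) (hX : Nonempty (X ≃L[ℝ] EllpEllTwo p)) :
    ∃ Y : Submodule ℝ (Lp ℝ p μ),
      Y ≤ X ∧ Nonempty (Y ≃L[ℝ] EllpEllTwo p) ∧ Y.ClosedComplemented := by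
  obtain ⟨e⟩ := hX
  let T : EllpEllTwo p →L[ℝ] Lp ℝ p μ := X.subtypeL.comp (e.symm : EllpEllTwo p →L[ℝ] X)
  set c : ℝ := (‖(e : X →L[ℝ] EllpEllTwo p)‖ + 1)⁻¹ with hc
  have hc0 : 0 < c := by positivity
  have hT : ∀ a, c * ‖a‖ ≤ ‖T a‖ := by
    intro a
    have h1 := (e : X →L[ℝ] EllpEllTwo p).le_opNorm (e.symm a)
    have h2 : (e : X →L[ℝ] EllpEllTwo p) (e.symm a) = a := e.apply_symm_apply a
    rw [h2] at h1
    have h3 : ‖T a‖ = ‖e.symm a‖ := rfl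
    rw [h3, hc, inv_mul_le_iff₀ (by positivity)]
    refine h1.trans ?_
    gcongr
    linarith
  obtain ⟨U, Q, hQ⟩ := exists_leftInverse_comp μ hp hp_top T hc0 hT
  obtain ⟨h1, h2⟩ := closedComplemented_range_of_leftInverse (T.comp U) Q hQ
  refine ⟨_, ?_, h1, h2⟩
  rintro _ ⟨a, rfl⟩
  exact (e.symm (U a)).2
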